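/- Let $M\ge 2$ be an integer power of $2$, let $n\ge 1$ be an integer and let $m\ge\tfrac12$. Let $X$ be uniformly distributed on the $M$-PSK constellation $\mathcal C=\{e^{j\pi(\frac{2k+1}{M}-1)}:k=0,\dots,M-1\}$, let $H$ be a circularly-symmetric complex fading coefficient whose magnitude is Nakagami-$m$ distributed with unit power, i.e. $|H|$ has density $f_R(r)=\frac{2m^m}{\Gamma(m)}r^{2m-1}e^{-mr^2}$ for $r\ge 0$, and let $W\sim\mathcal{CN}(0,1)$, with $X,H,W$ independent. For $\mathsf{SNR}>0$ let $Y=\sqrt{\mathsf{SNR}}\,HX+W$ be the received signal and let $Q$ be the $n$-bit phase quantizer, $Q(Y)=k$ if $\frac{2\pi}{2^n}k\le \mathrm{Arg}(Y)+\pi<\frac{2\pi}{2^n}(k+1)$, $k=0,\dots,2^n-1$, where $\mathrm{Arg}$ takes values in $[-\pi,\pi)$. Let $\hat x$ be an optimum detector, $\hat x(k,h)\in\arg\max_{x\in\mathcal C}\Pr\{X=x\mid Q(Y)=k,H=h\}$, and let $p(\mathsf{SNR})=\Pr\{X\ne\hat x(Q(Y),H)\}$ be its average symbol error probability. If $n\ge\log_2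 M$, then the diversity order $$\mathsf{DVO}=-\lim_{\mathsf{SNR}\to\infty}\frac{\log p(\mathsf{SNR})}{\log\mathsf{SNR}}$$ exists, and $$\mathsf{DVO}=\begin{cases}\tfrac12 & \text{if } n=\log_2 M,\\ m & \text{if } n\ge\log_2 M+1.\end{cases}$$ -/

import Mathlib

open MeasureTheory ProbabilityTheory Filter Topology

noncomputable section

namespace PhaseQuant

/-- The principal argument with values in `[-π, π)`. -/
def Arg (z : ℂ) : ℝ := if Complex.arg z = Real.pi then -Real.pi else Complex.arg z

lemma neg_pi_le_Arg (z : ℂ) : -Real.pi ≤ Arg z := by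
  unfold Arg
  split_ifs
  · exact le_rfl
  · exact (Complex.neg_pi_lt_arg z).le

lemma Arg_lt_pi (z : ℂ) : Arg z < Real.pi := by
  unfold Arg
  split_ifs with h
  · linarith [Real.pi_pos]
  · exact lt_of_le_of_ne (Complex.arg_le_pi z) h

lemma measurable_Arg : Measurable Arg :=
  Measurable.ite (measurableSet_eq_fun Complex.measurable_arg measurable_const)
    measurable_const Complex.measurable_arg

/-- The `M`-PSK constellation `{exp (jπ((2k+1)/M - 1)) : k = 0, …, M-1}`. -/
def constellation (M : ℕ) : Set ℂ :=
  Set.range fun k : Fin M =>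
    Complex.exp (Complex.I * ((Real.pi * ((2 * (k : ℝ) + 1) / M - 1) : ℝ) : ℂ))

/-- The `k`-th quantization cone `{z : (2π/2ⁿ) k ≤ Arg z + π < (2π/2ⁿ)(k+1)}`. -/
def region (n : ℕ) (k : Fin (2 ^ n)) : Set ℂ :=
  {z | 2 * Real.pi / 2 ^ n * (k : ℝ) ≤ Arg z + Real.pi ∧
    Arg z + Real.pi < 2 * Real.pi / 2 ^ n * ((k : ℝ) + 1)}

/-- The `n`-bit phase quantizer: the index of the cone containing `z`
(see `quantizer_eq_iff`). -/
def quantizer (n : ℕ) (z : ℂ) : Fin (2 ^ n) :=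
  ⟨⌊(Arg z + Real.pi) / (2 * Real.pi / 2 ^ n)⌋₊, by
    have hp := Real.pi_pos
    have h1 := neg_pi_le_Arg z
    have h2 := Arg_lt_pi z
    rw [Nat.floor_lt (div_nonneg (by linarith) (by positivity)), div_lt_iff₀ (by positivity)]
    push_cast
    have : (2 : ℝ) ^ n * (2 * Real.pi / 2 ^ n) = 2 * Real.pi := by field_simp
    linarith⟩

lemma quantizer_eq_iff (n : ℕ) (z : ℂ) (k : Fin (2 ^ n)) :
    quantizer n z = k ↔ z ∈ region n k := by
  have hp := Real.pi_pos
  have h1 := neg_pi_le_Arg z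
  have hc : 0 < 2 * Real.pi / 2 ^ n := by positivity
  rw [Fin.ext_iff]
  simp only [quantizer, region, Set.mem_ofPred_eq]
  rw [Nat.floor_eq_iff (div_nonneg (by linarith) hc.le), le_div_iff₀ hc, div_lt_iff₀ hc,
    mul_comm (k : ℝ), mul_comm ((k : ℝ) + 1)]

lemma measurable_quantizer (n : ℕ) : Measurable (quantizer n) := by
  refine measurable_to_countable' fun k => ?_
  have : quantizer n ⁻¹' {k} = region n k := by
    ext z
    simp [quantizer_eq_iff]
  rw [this]
  exact (measurableSet_le measurable_const (measurable_Arg.add_const _)).inter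
    (measurableSet_lt (measurable_Arg.add_const _) measurable_const)

/-- The Nakagami density with shape `m` and spread `s`:
`2 mᵐ / (Γ(m) sᵐ) r^(2m-1) exp (-(m/s) r²)` for `r ≥ 0`. -/
def nakagamiPDF (m s r : ℝ) : ℝ :=
  if 0 ≤ r then
    2 * m ^ m / (Real.Gamma m * s ^ m) * r ^ (2 * m - 1) * Real.exp (-(m / s) * r ^ 2)
  else 0

/-- The Nakagami distribution with shape `m` and spread `s`. -/
def nakagami (m s : ℝ) : Measure ℝ :=
  volume.withDensity fun r => ENNReal.ofReal (nakagamiPDF m s r)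

/-- The standard circularly-symmetric complex Gaussian distribution `CN(0,1)`, with density
`exp (-|w|²) / π`. -/
def stdComplexGaussian : Measure ℂ :=
  volume.withDensity fun w => ENNReal.ofReal (1 / Real.pi * Real.exp (-‖w‖ ^ 2))

variable {Ω : Type*} [MeasurableSpace Ω]

/-- The probabilistic model: an equiprobable `M`-PSK symbol `X`, a circularly-symmetric
unit-power fading coefficient `H` with Nakagami-`m` magnitude and standard complex Gaussian
noise `W`, all independent. -/
structure IsFadingPSKModel (P : Measure Ω) (M : ℕ) (m : ℝ) (X H W : Ω → ℂ) : Prop where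
  measurable_X : Measurable X
  measurable_H : Measurable H
  measurable_W : Measurable W
  X_mem : ∀ ω, X ω ∈ constellation M
  X_equiprobable : ∀ x ∈ constellation M, P {ω | X ω = x} = (M : ENNReal)⁻¹
  H_circular : ∀ θ : ℝ,
    P.map (fun ω => Complex.exp (Complex.I * (θ : ℂ)) * H ω) = P.map H
  H_magnitude : P.map (fun ω => ‖H ω‖) = nakagami m 1
  W_law : P.map W = stdComplexGaussian
  indep : iIndepFun ![X, H, W] P

/-- The received signal `Y = √SNR H X + W`. -/
def received (X H W : Ω → ℂ) (snr : ℝ) (ω : Ω) : ℂ :=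
  ((Real.sqrt snr : ℝ) : ℂ) * H ω * X ω + W ω

/-- What the detector observes: the pair `(Q(Y), H)`. -/
def observation (n : ℕ) (X H W : Ω → ℂ) (snr : ℝ) (ω : Ω) : Fin (2 ^ n) × ℂ :=
  (quantizer n (received X H W snr ω), H ω)

/-- `xhat (k, h)` is an optimum detector: a measurable rule that selects, for almost every
observation `(k, h)`, an element of the constellation that maximizes
`x ↦ P (X = x | Q(Y) = k, H = h)`. -/
def IsOptimumDetector (P : Measure Ω) [IsFiniteMeasure P] (M n : ℕ) (X H W : Ω → ℂ)
    (snr : ℝ) (xhat : Fin (2 ^ n) × ℂ → ℂ) : Prop :=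
  Measurable xhat ∧
    ∀ᵐ z ∂(P.map (observation n X H W snr)),
      xhat z ∈ constellation M ∧
      ∀ x ∈ constellation M,
        condDistrib X (observation n X H W snr) P z {x} ≤
          condDistrib X (observation n X H W snr) P z {xhat z}

/-- The average symbol error probability `P (X ≠ xhat (Q(Y), H))`. -/
def symbolErrorProb (P : Measure Ω) (n : ℕ) (X H W : Ω → ℂ) (snr : ℝ)
    (xhat : Fin (2 ^ n) × ℂ → ℂ) : ℝ :=
  P.real {ω | X ω ≠ xhat (observation n X H W snr ω)}

/-- The limit `- lim_{SNR → ∞} log p(SNR) / log SNR` exists and equals `d`. -/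
def HasDiversityOrder (p : ℝ → ℝ) (d : ℝ) : Prop :=
  Tendsto (fun snr => -(Real.log (p snr) / Real.log snr)) atTop (𝓝 d)

end PhaseQuant

end

/-!
Write `s = √SNR`. Two polynomial bounds on the error probability determine the diversity order
(`hasDiversityOrder_of_bounds`): one of the exact order from below, and one of every smaller order
from above.

*Lower bounds.* If two different symbols both put the received signal into the same cone with
probability bounded below, then no detector can tell them apart (`le_measure_ne_detector`). An open
cone has Gaussian measure bounded below uniformly over translations by vectors of norm at most `1`.
So this happens in a deep fade `‖s H‖ ≤ 1`, which has probability of order `s ^ (-2m)`. If there are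
exactly `M` cones, it also happens whenever a rotated symbol `s H x` lies within distance `1` of the
first boundary ray of a cone: its neighbour then lies within distance `1` of the second boundary
ray, and a cone absorbs translations along its boundary rays. As the phase of `H` is uniform, this
has probability of order at least `1 / s`.

*Upper bounds.* The optimum detector is at least as good as any other rule
(`symbolErrorProb_le_of_disjoint`). With at least `2M` cones, the width of a cone is at most half of
the angle between neighbouring symbols, so a cone is compatible with only one symbol unless
`‖W‖ ≥ c s ‖H‖`; the probability of this is at most a constant times `E[‖W‖ ^ (2m)] s ^ (-2m)`. With
`M` cones, each cone contains at most one of the rotated symbols `H x`, and the noise does not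
change the cone of `s H x` unless `‖W‖` exceeds the distance from `s H x` to one of the boundary
lines. By circular symmetry this distance is distributed as `s |Im H|`, and
`P(|Im H| ≤ ε) ≤ E[‖H‖ ^ (-a)] ε ^ a` for every `a < 1`; the negative moment is finite because
`a < 1 ≤ 2m`. The exponent `a = 1` itself is not available at `m = 1/2`, where the moment diverges
logarithmically, but the limit does not see this.
-/

/-! ### The geometry of the quantization cones and of the constellation -/

namespace PhaseQuant

open scoped ComplexConjugate

/-- The unit vector of the boundary ray between the quantization cones `j - 1` and `j`, in the
direction of argument `2πj/2ⁿ - π`. -/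
noncomputable def boundaryRay (n j : ℕ) : ℂ :=
  Complex.exp (((2 * Real.pi / 2 ^ n * j - Real.pi : ℝ) : ℂ) * Complex.I)

/-- The signed distance of `z` to the line spanned by `boundaryRay n j`, positive on the
counterclockwise side. -/
noncomputable def boundaryCoord (n j : ℕ) (z : ℂ) : ℝ := (conj (boundaryRay n j) * z).im

lemma norm_boundaryRay (n j : ℕ) : ‖boundaryRay n j‖ = 1 := by
  rw [boundaryRay, Complex.norm_exp_ofReal_mul_I]

lemma boundaryRay_add (n j i : ℕ) : boundaryRay n (j + i) =
    boundaryRay n j * Complex.exp (((2 * Real.pi / 2 ^ n * i : ℝ) : ℂ) * Complex.I) := by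
  rw [boundaryRay, boundaryRay, ← Complex.exp_add]
  congr 1
  push_cast
  ring

lemma norm_mul_exp_Arg_mul_I (z : ℂ) : (‖z‖ : ℂ) * Complex.exp ((Arg z : ℂ) * Complex.I) = z := by
  have h := Complex.norm_mul_exp_arg_mul_I z
  unfold Arg
  split_ifs with hz
  · rw [hz, Complex.exp_pi_mul_I] at h
    rw [Complex.ofReal_neg, neg_mul, Complex.exp_neg, Complex.exp_pi_mul_I]
    simpa using h
  · exact h

lemma boundaryCoord_eq (n j : ℕ) (z : ℂ) :
    boundaryCoord n j z = ‖z‖ * Real.sin (Arg z + Real.pi - 2 * Real.pi / 2 ^ n * j) := by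
  have h : conj (boundaryRay n j) * z = (‖z‖ : ℂ) * Complex.exp
      (((Arg z + Real.pi - 2 * Real.pi / 2 ^ n * j : ℝ) : ℂ) * Complex.I) := by
    conv_lhs => rw [← norm_mul_exp_Arg_mul_I z]
    rw [boundaryRay, ← Complex.exp_conj, mul_left_comm, ← Complex.exp_add]
    congr 2
    simp only [map_mul, Complex.conj_ofReal, Complex.conj_I]
    push_cast
    ring
  rw [boundaryCoord, h, Complex.im_ofReal_mul,
    Complex.exp_ofReal_mul_I_im]

lemma boundaryCoord_add (n j : ℕ) (z w : ℂ) :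
    boundaryCoord n j (z + w) = boundaryCoord n j z + boundaryCoord n j w := by
  simp [boundaryCoord, mul_add]

lemma boundaryCoord_ofReal_mul (n j : ℕ) (r : ℝ) (z : ℂ) :
    boundaryCoord n j (r * z) = r * boundaryCoord n j z := by
  rw [boundaryCoord, mul_left_comm, Complex.im_ofReal_mul, boundaryCoord]

lemma abs_boundaryCoord_le (n j : ℕ) (z : ℂ) : |boundaryCoord n j z| ≤ ‖z‖ := by
  refine (Complex.abs_im_le_norm _).trans ?_
  rw [norm_mul, RCLike.norm_conj, norm_boundaryRay, one_mul]

lemma boundaryCoord_boundaryRay (n j i : ℕ) : boundaryCoord n j (boundaryRay n i) =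
    Real.sin (2 * Real.pi / 2 ^ n * ((i : ℝ) - j)) := by
  rw [boundaryCoord, boundaryRay, boundaryRay, ← Complex.exp_conj, ← Complex.exp_add,
    ← Complex.exp_ofReal_mul_I_im]
  congr 2
  simp only [map_mul, Complex.conj_ofReal, Complex.conj_I]
  push_cast
  ring

/-- The width of a cone is at most `π` as soon as there are two of them. -/
lemma width_le_pi {n : ℕ} (hn : 1 ≤ n) : 2 * Real.pi / 2 ^ n ≤ Real.pi := by
  have h2 : (2 : ℝ) ≤ 2 ^ n := by
    calc (2 : ℝ) = 2 ^ 1 := by norm_num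
      _ ≤ 2 ^ n := pow_le_pow_right₀ (by norm_num) hn
  rw [div_le_iff₀ (by positivity)]
  nlinarith [Real.pi_pos]

lemma boundaryCoord_nonneg_of_mem_region {n : ℕ} (hn : 1 ≤ n) {k : Fin (2 ^ n)} {z : ℂ}
    (hz : z ∈ region n k) : 0 ≤ boundaryCoord n k z := by
  have hw := width_le_pi hn
  obtain ⟨h1, h2⟩ := hz
  rw [boundaryCoord_eq]
  exact mul_nonneg (norm_nonneg _)
    (Real.sin_nonneg_of_nonneg_of_le_pi (by linarith) (by linarith))

lemma boundaryCoord_succ_nonpos_of_mem_region {n : ℕ} (hn : 1 ≤ n) {k : Fin (2 ^ n)} {z : ℂ}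
    (hz : z ∈ region n k) : boundaryCoord n (k + 1) z ≤ 0 := by
  have hw := width_le_pi hn
  obtain ⟨h1, h2⟩ := hz
  rw [boundaryCoord_eq]
  push_cast
  exact mul_nonpos_of_nonneg_of_nonpos (norm_nonneg _)
    (Real.sin_nonpos_of_nonpos_of_neg_pi_le (by linarith) (by linarith))

/-- The open cone inside the `k`-th region, cut out by two linear inequalities. -/
def openSector (n k : ℕ) : Set ℂ := {z | 0 < boundaryCoord n k z ∧ boundaryCoord n (k + 1) z < 0}

lemma openSector_subset_region {n : ℕ} (hn : 1 ≤ n) (k : Fin (2 ^ n)) :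
    openSector n k ⊆ region n k := by
  rintro z ⟨h1, h2⟩
  have hw := width_le_pi hn
  have hpi := Real.pi_pos
  have hα0 := neg_pi_le_Arg z
  have hα1 := Arg_lt_pi z
  have hN : (0 : ℝ) < 2 ^ n := by positivity
  have hd : 0 < 2 * Real.pi / 2 ^ n := by positivity
  have hk0 : 0 ≤ 2 * Real.pi / 2 ^ n * (k : ℝ) := by positivity
  have hk1 : 2 * Real.pi / 2 ^ n * ((k : ℝ) + 1) ≤ 2 * Real.pi := by
    have : ((k : ℕ) : ℝ) + 1 ≤ 2 ^ n := by exact_mod_cast k.2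
    calc _ ≤ 2 * Real.pi / 2 ^ n * 2 ^ n := by gcongr
      _ = 2 * Real.pi := by field_simp
  rw [boundaryCoord_eq] at h1 h2
  have hs1 := pos_of_mul_pos_right h1 (norm_nonneg z)
  have hs2 : Real.sin (Arg z + Real.pi - 2 * Real.pi / 2 ^ n * ((k + 1 : ℕ) : ℝ)) < 0 := by
    by_contra! h
    exact absurd h2 (not_lt.2 (mul_nonneg (norm_nonneg z) h))
  push_cast at hs2
  constructor
  · by_contra! hlt
    -- the first sine is positive at an angle in `(-2π, 0)`, so this angle is below `-π`, and the
    -- second sine then forces the angle `Arg z + π` to be negative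
    have ha : Arg z + Real.pi - 2 * Real.pi / 2 ^ n * (k : ℝ) < -Real.pi := by
      by_contra! h
      exact absurd hs1 (not_lt.2 (Real.sin_nonpos_of_nonpos_of_neg_pi_le (by linarith) h))
    have := Real.sin_nonneg_of_nonneg_of_le_pi
      (x := Arg z + Real.pi - 2 * Real.pi / 2 ^ n * ((k : ℝ) + 1) + 2 * Real.pi)
      (by linarith) (by linarith)
    rw [Real.sin_add_two_pi] at this
    linarith
  · by_contra! hle
    have ha : Real.pi < Arg z + Real.pi - 2 * Real.pi / 2 ^ n * ((k : ℝ) + 1) := by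
      by_contra! h
      exact absurd hs2 (not_lt.2 (Real.sin_nonneg_of_nonneg_of_le_pi (by linarith) h))
    have := Real.sin_nonpos_of_nonpos_of_neg_pi_le
      (x := Arg z + Real.pi - 2 * Real.pi / 2 ^ n * (k : ℝ) - 2 * Real.pi)
      (by linarith) (by linarith)
    rw [Real.sin_sub_two_pi] at this
    linarith

/-- Noise that is smaller than the distance to all boundary lines does not change the cone. -/
lemma add_mem_region {n : ℕ} (hn : 1 ≤ n) {k : Fin (2 ^ n)} {z w : ℂ} (hz : z ∈ region n k)
    (hw : ∀ j ∈ Finset.range (2 ^ n + 1), ‖w‖ < |boundaryCoord n j z|) : z + w ∈ region n k := by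
  have h1 := hw k (Finset.mem_range.2 (by have := k.2; omega))
  have h2 := hw (k + 1) (Finset.mem_range.2 (by have := k.2; omega))
  rw [abs_of_nonneg (boundaryCoord_nonneg_of_mem_region hn hz)] at h1
  rw [abs_of_nonpos (boundaryCoord_succ_nonpos_of_mem_region hn hz)] at h2
  have h3 := abs_le.1 (abs_boundaryCoord_le n k w)
  have h4 := abs_le.1 (abs_boundaryCoord_le n (k + 1) w)
  refine openSector_subset_region hn k ⟨?_, ?_⟩ <;> rw [boundaryCoord_add] <;> linarith

/-- An open cone absorbs translations along its first boundary ray. -/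
lemma add_boundaryRay_mem_openSector {n : ℕ} (hn : 1 ≤ n) (k : ℕ) {ρ : ℝ} (hρ : 0 ≤ ρ) {z : ℂ}
    (hz : z ∈ openSector n k) : ρ * boundaryRay n k + z ∈ openSector n k := by
  have hw := width_le_pi hn
  have hd : 0 < 2 * Real.pi / 2 ^ n := by positivity
  constructor
  · simpa [boundaryCoord_add, boundaryCoord_ofReal_mul, boundaryCoord_boundaryRay] using hz.1
  · rw [boundaryCoord_add, boundaryCoord_ofReal_mul, boundaryCoord_boundaryRay]
    have := mul_nonpos_of_nonneg_of_nonpos hρ (Real.sin_nonpos_of_nonpos_of_neg_pi_le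
      (x := 2 * Real.pi / 2 ^ n * ((k : ℝ) - ((k + 1 : ℕ) : ℝ)))
      (by push_cast; linarith) (by push_cast; linarith))
    linarith [hz.2]

/-- An open cone absorbs translations along its second boundary ray. -/
lemma add_boundaryRay_succ_mem_openSector {n : ℕ} (hn : 1 ≤ n) (k : ℕ) {ρ : ℝ} (hρ : 0 ≤ ρ)
    {z : ℂ} (hz : z ∈ openSector n k) :
    ρ * boundaryRay n (k + 1) + z ∈ openSector n k := by
  have hw := width_le_pi hn
  have hd : 0 < 2 * Real.pi / 2 ^ n := by positivity
  constructor
  · rw [boundaryCoord_add, boundaryCoord_ofReal_mul, boundaryCoord_boundaryRay]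
    have := mul_nonneg hρ (Real.sin_nonneg_of_nonneg_of_le_pi
      (x := 2 * Real.pi / 2 ^ n * (((k + 1 : ℕ) : ℝ) - (k : ℝ)))
      (by push_cast; linarith) (by push_cast; linarith))
    linarith [hz.1]
  · simpa [boundaryCoord_add, boundaryCoord_ofReal_mul, boundaryCoord_boundaryRay] using hz.2

/-- An open cone contains a ball of radius `2`; hence all its translates by vectors of norm at most
`1` contain a common ball of radius `1`. -/
lemma exists_ball_subset_openSector {n : ℕ} (hn : 1 ≤ n) (k : ℕ) :
    ∃ q : ℂ, ∀ z, ‖z - q‖ < 2 → z ∈ openSector n k := by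
  have hw := width_le_pi hn
  have hd : 0 < 2 * Real.pi / 2 ^ n := by positivity
  -- the point on the bisector whose distance to both boundary rays is `2`
  have hs : 0 < Real.sin (2 * Real.pi / 2 ^ n / 2) :=
    Real.sin_pos_of_pos_of_lt_pi (by linarith) (by linarith [Real.pi_pos])
  set s := Real.sin (2 * Real.pi / 2 ^ n / 2) with hs_def
  set e := Complex.exp (((2 * Real.pi / 2 ^ n * (k + 1 / 2) - Real.pi : ℝ) : ℂ) * Complex.I)
    with he
  have hcoord : ∀ j : ℕ, boundaryCoord n j e =
      Real.sin (2 * Real.pi / 2 ^ n * ((k : ℝ) + 1 / 2 - j)) := by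
    intro j
    rw [boundaryCoord, boundaryRay, he, ← Complex.exp_conj, ← Complex.exp_add,
      ← Complex.exp_ofReal_mul_I_im]
    congr 2
    simp only [map_mul, Complex.conj_ofReal, Complex.conj_I]
    push_cast
    ring
  have h1 : boundaryCoord n k e = s := by
    rw [hcoord, hs_def]; congr 1; ring
  have h2 : boundaryCoord n (k + 1) e = -s := by
    rw [hcoord, hs_def, ← Real.sin_neg]; congr 1; push_cast; ring
  refine ⟨((2 / s : ℝ) : ℂ) * e, fun z hz => ?_⟩
  have hz1 := (abs_le.1 (abs_boundaryCoord_le n k (z - ((2 / s : ℝ) : ℂ) * e))).1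
  have hz2 := (abs_le.1 (abs_boundaryCoord_le n (k + 1) (z - ((2 / s : ℝ) : ℂ) * e))).2
  have hzz : z = ((2 / s : ℝ) : ℂ) * e + (z - ((2 / s : ℝ) : ℂ) * e) := by ring
  have h2s : 2 / s * s = 2 := by field_simp
  constructor
  · rw [hzz, boundaryCoord_add, boundaryCoord_ofReal_mul, h1]; linarith
  · rw [hzz, boundaryCoord_add, boundaryCoord_ofReal_mul, h2]; linarith

open InnerProductGeometry

lemma angle_lt_of_mem_region {n : ℕ} (hn : 1 ≤ n) {k : Fin (2 ^ n)} {y z : ℂ} (hy0 : y ≠ 0)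
    (hz0 : z ≠ 0) (hy : y ∈ region n k) (hz : z ∈ region n k) :
    angle y z < 2 * Real.pi / 2 ^ n := by
  have hw := width_le_pi hn
  obtain ⟨h1, h2⟩ := hy
  obtain ⟨h3, h4⟩ := hz
  rw [← norm_mul_exp_Arg_mul_I y, ← norm_mul_exp_Arg_mul_I z,
    ← Complex.real_smul (x := ‖y‖), ← Complex.real_smul (x := ‖z‖), angle_smul_left_of_pos _ _ (norm_pos_iff.2 hy0),
    angle_smul_right_of_pos _ _ (norm_pos_iff.2 hz0), Complex.angle_exp_exp,
    (toIocMod_eq_self _).2 ⟨by linarith, by linarith⟩, abs_lt]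
  constructor <;> linarith

lemma norm_of_mem_constellation {M : ℕ} {x : ℂ} (hx : x ∈ constellation M) : ‖x‖ = 1 := by
  obtain ⟨k, rfl⟩ := hx
  dsimp only
  rw [mul_comm, Complex.norm_exp_ofReal_mul_I]

lemma finite_constellation (M : ℕ) : (constellation M).Finite := Set.finite_range _

/-- Distinct points of the constellation are at least `2π/M` apart. -/
lemma le_angle_of_mem_constellation {M : ℕ} {x y : ℂ} (hx : x ∈ constellation M)
    (hy : y ∈ constellation M) (hxy : x ≠ y) : 2 * Real.pi / M ≤ angle x y := by
  obtain ⟨i, rfl⟩ := hx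
  obtain ⟨j, rfl⟩ := hy
  have hij : i ≠ j := fun h => hxy (by rw [h])
  have hM : (0 : ℝ) < M := by exact_mod_cast i.pos
  dsimp only
  rw [mul_comm Complex.I, mul_comm Complex.I, Complex.angle_exp_exp, toIocMod]
  set q := toIocDiv Real.two_pi_pos (-Real.pi)
    (Real.pi * ((2 * (i : ℝ) + 1) / M - 1) - Real.pi * ((2 * (j : ℝ) + 1) / M - 1))
  have hint : (1 : ℝ) ≤ |(((i : ℕ) : ℤ) - (j : ℕ) - q * M : ℤ)| := by
    have : ((i : ℕ) : ℤ) - (j : ℕ) - q * M ≠ 0 := by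
      intro h
      have hi := i.2
      have hj := j.2
      have hq : q = 0 := by
        by_contra hq
        have h1 : (M : ℤ) ∣ ((i : ℕ) : ℤ) - (j : ℕ) := ⟨q, by linarith⟩
        have h2 : ((i : ℕ) : ℤ) - (j : ℕ) ≠ 0 := by
          intro h'; apply hij; ext; omega
        have := Int.le_of_dvd (abs_pos.2 h2) ((dvd_abs _ _).2 h1)
        rcases abs_cases (((i : ℕ) : ℤ) - (j : ℕ)) with h | h <;> omega
      rw [hq] at h
      apply hij; ext; omega
    exact_mod_cast Int.one_le_abs this
  have : Real.pi * ((2 * (i : ℝ) + 1) / M - 1) - Real.pi * ((2 * (j : ℝ) + 1) / M - 1) -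
      q • (2 * Real.pi) = 2 * Real.pi / M * ((((i : ℕ) : ℤ) - (j : ℕ) - q * M : ℤ) : ℝ) := by
    rw [zsmul_eq_mul]
    push_cast
    field_simp
    ring
  rw [this, abs_mul, abs_of_pos (by positivity)]
  have h0 : 0 < 2 * Real.pi / M := by positivity
  push_cast at hint ⊢
  nlinarith

/-- A perturbation of relative size less than some `c` turns a vector by less than `δ`. -/
lemma exists_angle_add_lt {δ : ℝ} (hδ : 0 < δ) :
    ∃ c : ℝ, 0 < c ∧ c ≤ 1 ∧ ∀ z w : ℂ, z ≠ 0 → ‖w‖ < c * ‖z‖ → angle z (z + w) < δ := by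
  have hc : ContinuousAt (fun w : ℂ => angle (1 : ℂ) (1 + w)) 0 := by
    have h1 : ContinuousAt (fun p : ℂ × ℂ => angle p.1 p.2) ((1 : ℂ), 1 + (0 : ℂ)) :=
      continuousAt_angle (by simp) (by simp)
    have h2 : ContinuousAt (fun w : ℂ => ((1 : ℂ), 1 + w)) 0 := by fun_prop
    exact ContinuousAt.comp (f := fun w : ℂ => ((1 : ℂ), 1 + w)) h1 h2
  obtain ⟨c, hc0, hc⟩ := Metric.continuousAt_iff.1 hc δ hδ
  refine ⟨min c 1, by positivity, min_le_right _ _, fun z w hz hw => ?_⟩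
  have hz' := norm_pos_iff.2 hz
  have hwz : ‖w / z‖ < c := by
    rw [norm_div, div_lt_iff₀ hz']
    exact hw.trans_le (by gcongr; exact min_le_left _ _)
  have h := hc (x := w / z) (by simpa using hwz)
  have he : z + w = z * (1 + w / z) := by field_simp
  have : angle z (z + w) = angle (1 : ℂ) (1 + w / z) := by
    conv_lhs => rw [he]; arg 1; rw [← mul_one z]
    rw [Complex.angle_mul_left hz]
  rw [this]
  simp only [add_zero, angle_self one_ne_zero, Real.dist_eq, sub_zero] at h
  exact (abs_lt.1 h).2

end PhaseQuant

/-! ### Error probabilities of detectors -/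

namespace PhaseQuant

lemma measurableSet_region (n : ℕ) (k : Fin (2 ^ n)) : MeasurableSet (region n k) := by
  have : region n k = quantizer n ⁻¹' {k} := by
    ext z
    simp [quantizer_eq_iff]
  rw [this]
  exact measurable_quantizer n (measurableSet_singleton k)

namespace IsFadingPSKModel

variable {Ω : Type*} [MeasurableSpace Ω] {P : Measure Ω} {M n : ℕ}
  {m : ℝ} {X H W : Ω → ℂ} {snr : ℝ} {xhat : Fin (2 ^ n) × ℂ → ℂ}

lemma measurable_observation (hmodel : IsFadingPSKModel P M m X H W) (n : ℕ) (snr : ℝ) :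
    Measurable (observation n X H W snr) := by
  have h1 := hmodel.measurable_X
  have h2 := hmodel.measurable_H
  have h3 := hmodel.measurable_W
  refine Measurable.prodMk ((measurable_quantizer n).comp ?_) h2
  unfold received
  fun_prop

variable [IsProbabilityMeasure P]

lemma isProbabilityMeasure_stdComplexGaussian (hmodel : IsFadingPSKModel P M m X H W) :
    IsProbabilityMeasure stdComplexGaussian := by
  rw [← hmodel.W_law]
  exact Measure.isProbabilityMeasure_map hmodel.measurable_W.aemeasurable

lemma map_prodMk_eq_prod (hmodel : IsFadingPSKModel P M m X H W) :
    P.map (fun ω => (H ω, W ω)) = (P.map H).prod stdComplexGaussian := by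
  have h : IndepFun H W P := hmodel.indep.indepFun (i := 1) (j := 2) (by decide)
  rw [← hmodel.W_law]
  exact (indepFun_iff_map_prod_eq_prod_map_map hmodel.measurable_H.aemeasurable
    hmodel.measurable_W.aemeasurable).1 h

lemma measure_prodMk_mem (hmodel : IsFadingPSKModel P M m X H W) {T : Set (ℂ × ℂ)}
    (hT : MeasurableSet T) :
    P {ω | (H ω, W ω) ∈ T} = ∫⁻ h, stdComplexGaussian {w | (h, w) ∈ T} ∂(P.map H) := by
  have := hmodel.isProbabilityMeasure_stdComplexGaussian
  have h := Measure.prod_apply (μ := P.map H) (ν := stdComplexGaussian) hT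
  rw [← hmodel.map_prodMk_eq_prod,
    Measure.map_apply (hmodel.measurable_H.prodMk hmodel.measurable_W) hT] at h
  exact h

lemma measure_prodMk_mem' (hmodel : IsFadingPSKModel P M m X H W) {T : Set (ℂ × ℂ)}
    (hT : MeasurableSet T) :
    P {ω | (H ω, W ω) ∈ T} = ∫⁻ w, P.map H {h | (h, w) ∈ T} ∂stdComplexGaussian := by
  have := hmodel.isProbabilityMeasure_stdComplexGaussian
  have h := Measure.prod_apply_symm (μ := P.map H) (ν := stdComplexGaussian) hT
  rw [← hmodel.map_prodMk_eq_prod,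
    Measure.map_apply (hmodel.measurable_H.prodMk hmodel.measurable_W) hT] at h
  exact h

lemma measure_symbol_inter (hmodel : IsFadingPSKModel P M m X H W) {x : ℂ}
    (hx : x ∈ constellation M) {T : Set (ℂ × ℂ)} (hT : MeasurableSet T) :
    P {ω | X ω = x ∧ (H ω, W ω) ∈ T} =
      (M : ENNReal)⁻¹ * ∫⁻ h, stdComplexGaussian {w | (h, w) ∈ T} ∂(P.map H) := by
  have hmeas : ∀ i : Fin 3, Measurable (![X, H, W] i) := by
    intro i
    fin_cases i
    exacts [hmodel.measurable_X, hmodel.measurable_H, hmodel.measurable_W]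
  have hind : IndepFun (fun ω => (H ω, W ω)) X P :=
    hmodel.indep.indepFun_prodMk hmeas 1 2 0 (by decide) (by decide)
  have := hind.symm.measure_inter_preimage_eq_mul {x} T (measurableSet_singleton x) hT
  rw [← hmodel.measure_prodMk_mem hT, ← hmodel.X_equiprobable x hx]
  exact this

/-- A decision rule `g` is right with probability `E[P(X = g(z) | z)]`. -/
lemma measure_eq_detector (hmodel : IsFadingPSKModel P M m X H W) {g : Fin (2 ^ n) × ℂ → ℂ}
    (hg : Measurable g) :
    P {ω | X ω = g (observation n X H W snr ω)} =
      ∫⁻ z, condDistrib X (observation n X H W snr) P z {g z}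
        ∂(P.map (observation n X H W snr)) := by
  have hobs := hmodel.measurable_observation n snr
  have hS : MeasurableSet {p : (Fin (2 ^ n) × ℂ) × ℂ | p.2 = g p.1} :=
    measurableSet_eq_fun measurable_snd (hg.comp measurable_fst)
  have h := congrArg (fun μ : Measure ((Fin (2 ^ n) × ℂ) × ℂ) => μ {p : (Fin (2 ^ n) × ℂ) × ℂ | p.2 = g p.1})
    (compProd_map_condDistrib (μ := P) (X := observation n X H W snr)
      hmodel.measurable_X.aemeasurable)
  rw [Measure.compProd_apply hS, Measure.map_apply (hobs.prodMk hmodel.measurable_X) hS] at h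
  exact h.symm

/-- Among all decision rules, the optimum detector has the least symbol error probability. -/
lemma symbolErrorProb_le (hmodel : IsFadingPSKModel P M m X H W)
    (hopt : IsOptimumDetector P M n X H W snr xhat) {g : Fin (2 ^ n) × ℂ → ℂ}
    (hg : Measurable g) :
    symbolErrorProb P n X H W snr xhat ≤ P.real {ω | X ω ≠ g (observation n X H W snr ω)} := by
  have hobs := hmodel.measurable_observation n snr
  have hX := hmodel.measurable_X
  have hC : MeasurableSet (constellation M) := (finite_constellation M).measurableSet
  have hae : ∀ᵐ z ∂(P.map (observation n X H W snr)),
      ∀ᵐ x ∂(condDistrib X (observation n X H W snr) P z), x ∈ constellation M := by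
    have : ∀ᵐ p ∂(P.map (observation n X H W snr) ⊗ₘ
        condDistrib X (observation n X H W snr) P), p.2 ∈ constellation M := by
      rw [compProd_map_condDistrib hX.aemeasurable,
        ae_map_iff (hobs.prodMk hX).aemeasurable (measurable_snd hC)]
      exact Eventually.of_forall hmodel.X_mem
    exact Measure.ae_ae_of_ae_compProd this
  have hle : P {ω | X ω = g (observation n X H W snr ω)} ≤
      P {ω | X ω = xhat (observation n X H W snr ω)} := by
    rw [hmodel.measure_eq_detector hg, hmodel.measure_eq_detector hopt.1]
    refine lintegral_mono_ae ?_
    filter_upwards [hopt.2, hae] with z hz hz'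
    by_cases hgz : g z ∈ constellation M
    · exact hz.2 _ hgz
    · have h0 : condDistrib X (observation n X H W snr) P z {g z} = 0 :=
        measure_mono_null (by rintro _ rfl; exact hgz) hz'
      rw [h0]
      exact zero_le
  have hc : ∀ f : Fin (2 ^ n) × ℂ → ℂ, Measurable f →
      P.real {ω | X ω ≠ f (observation n X H W snr ω)} =
        1 - P.real {ω | X ω = f (observation n X H W snr ω)} := by
    intro f hf
    exact probReal_compl_eq_one_sub (measurableSet_eq_fun hX (hf.comp hobs))
  rw [symbolErrorProb, hc _ hopt.1, hc _ hg]
  have := ENNReal.toReal_mono (measure_ne_top _ _) hle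
  simp only [Measure.real]
  linarith

/-- If disjoint sets `A x` of observations are declared compatible with the symbols `x`, an error
of the optimum detector is at most as likely as an observation that is not compatible with the
symbol sent. -/
lemma symbolErrorProb_le_of_disjoint (hmodel : IsFadingPSKModel P M m X H W)
    (hopt : IsOptimumDetector P M n X H W snr xhat) {A : ℂ → Set (Fin (2 ^ n) × ℂ)}
    (hA : ∀ x ∈ constellation M, MeasurableSet (A x))
    (hdisj : ∀ x ∈ constellation M, ∀ y ∈ constellation M, ∀ z, z ∈ A x → z ∈ A y → x = y) :
    symbolErrorProb P n X H W snr xhat ≤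
      P.real {ω | observation n X H W snr ω ∉ A (X ω)} := by
  classical
  set C := (finite_constellation M).toFinset with hC
  have hmem : ∀ x, x ∈ C ↔ x ∈ constellation M := fun x => by simp [hC]
  set g : Fin (2 ^ n) × ℂ → ℂ := fun z => ∑ x ∈ C, (A x).indicator (fun _ => x) z with hg
  have hgm : Measurable g := Finset.measurable_fun_sum C fun x hx =>
    measurable_const.indicator (hA x ((hmem x).1 hx))
  refine (hmodel.symbolErrorProb_le hopt hgm).trans (measureReal_mono ?_ (by finiteness))
  intro ω hω hcontra
  apply hω
  rw [hg]
  dsimp only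
  rw [Finset.sum_eq_single_of_mem (X ω) ((hmem _).2 (hmodel.X_mem ω)),
    Set.indicator_of_mem hcontra]
  intro y hy hne
  refine Set.indicator_of_notMem (fun h => hne ?_) _
  exact hdisj y ((hmem y).1 hy) _ (hmodel.X_mem ω) _ h hcontra

/-- If, for fading coefficients in `B`, two different symbols are both received in the same cone
with probability at least `c`, no detector can tell them apart. -/
lemma le_measure_ne_detector (hmodel : IsFadingPSKModel P M m X H W) (hg : Measurable xhat)
    {x₁ x₂ : ℂ} (hx₁ : x₁ ∈ constellation M) (hx₂ : x₂ ∈ constellation M) (hne : x₁ ≠ x₂)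
    (k : Fin (2 ^ n)) {B : Set ℂ} (hB : MeasurableSet B) {c : ENNReal}
    (hc₁ : ∀ h ∈ B, c ≤ stdComplexGaussian {w | (Real.sqrt snr : ℂ) * h * x₁ + w ∈ region n k})
    (hc₂ : ∀ h ∈ B, c ≤ stdComplexGaussian {w | (Real.sqrt snr : ℂ) * h * x₂ + w ∈ region n k}) :
    (M : ENNReal)⁻¹ * (c * P.map H B) ≤ P {ω | X ω ≠ xhat (observation n X H W snr ω)} := by
  -- the event that `x` is sent, `H ∈ B'` and the cone `k` is observed
  have key : ∀ x ∈ constellation M, ∀ B' : Set ℂ, MeasurableSet B' → B' ⊆ B →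
      (∀ h ∈ B, c ≤ stdComplexGaussian {w | (Real.sqrt snr : ℂ) * h * x + w ∈ region n k}) →
      (M : ENNReal)⁻¹ * (c * P.map H B') ≤ P {ω | X ω = x ∧ (H ω, W ω) ∈
        {p : ℂ × ℂ | p.1 ∈ B' ∧ (Real.sqrt snr : ℂ) * p.1 * x + p.2 ∈ region n k}} := by
    intro x hx B' hB' hBB hc
    have hT : MeasurableSet
        {p : ℂ × ℂ | p.1 ∈ B' ∧ (Real.sqrt snr : ℂ) * p.1 * x + p.2 ∈ region n k} :=
      (measurable_fst hB').inter
        ((by fun_prop : Measurable fun p : ℂ × ℂ => (Real.sqrt snr : ℂ) * p.1 * x + p.2)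
          (measurableSet_region n k))
    rw [hmodel.measure_symbol_inter hx hT]
    gcongr
    rw [← setLIntegral_const]
    refine (setLIntegral_mono' hB' ?_).trans (setLIntegral_le_lintegral B' _)
    intro h hh
    refine (hc h (hBB hh)).trans (measure_mono fun w hw => ?_)
    exact ⟨hh, hw⟩
  have hgk : Measurable fun h => xhat (k, h) := hg.comp (by fun_prop)
  have hD : MeasurableSet {h | xhat (k, h) = x₁} := hgk (measurableSet_singleton x₁)
  have hX := hmodel.measurable_X
  have hobs := hmodel.measurable_observation n snr
  have h1 := key x₁ hx₁ (B \ {h | xhat (k, h) = x₁}) (hB.diff hD) Set.sdiff_subset hc₁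
  have h2 := key x₂ hx₂ (B ∩ {h | xhat (k, h) = x₁}) (hB.inter hD) Set.inter_subset_left hc₂
  rw [← measure_inter_add_sdiff B hD, mul_add, mul_add, add_comm]
  refine (add_le_add h1 h2).trans ?_
  have hsplit : MeasurableSet {ω | X ω = x₁} := hX (measurableSet_singleton x₁)
  rw [← measure_inter_add_sdiff {ω | X ω ≠ xhat (observation n X H W snr ω)} hsplit]
  have hq : ∀ ω x, X ω = x → (Real.sqrt snr : ℂ) * H ω * x + W ω ∈ region n k →
      observation n X H W snr ω = (k, H ω) := by
    rintro ω x rfl hk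
    exact Prod.ext ((quantizer_eq_iff n (received X H W snr ω) k).2 hk) rfl
  refine add_le_add (measure_mono ?_) (measure_mono ?_)
  · rintro ω ⟨hx, ⟨_, hn⟩, hk⟩
    refine ⟨?_, hx⟩
    change X ω ≠ xhat (observation n X H W snr ω)
    rw [hq ω _ hx hk, hx]
    exact fun h => hn h.symm
  · rintro ω ⟨hx, ⟨_, hn⟩, hk⟩
    refine ⟨?_, fun h => hne (h.symm.trans hx)⟩
    change X ω ≠ xhat (observation n X H W snr ω)
    rw [hq ω _ hx hk, hx]
    intro h
    exact hne (h.trans hn).symm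

end IsFadingPSKModel

end PhaseQuant

/-! ### The distributions of fading and noise -/

namespace PhaseQuant

/-- The density of the unit-spread Nakagami law on the positive half-line. -/
lemma nakagamiPDF_one {m r : ℝ} (hr : 0 < r) : nakagamiPDF m 1 r =
    2 * m ^ m / Real.Gamma m * (r ^ (2 * m - 1) * Real.exp (-m * r ^ 2)) := by
  rw [nakagamiPDF, if_pos hr.le, Real.one_rpow, mul_one, div_one, mul_assoc]

lemma nakagami_const_pos {m : ℝ} (hm : 0 < m) : 0 < 2 * m ^ m / Real.Gamma m := by
  have := Real.Gamma_pos_of_pos hm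
  positivity

lemma measurable_nakagamiPDF (m s : ℝ) : Measurable (nakagamiPDF m s) := by
  unfold nakagamiPDF
  exact Measurable.ite measurableSet_Ici (by fun_prop) measurable_const

lemma lintegral_nakagami (m : ℝ) {f : ℝ → ENNReal} (hf : Measurable f) :
    ∫⁻ r, f r ∂(nakagami m 1) =
      ∫⁻ r in Set.Ioi 0, ENNReal.ofReal (nakagamiPDF m 1 r) * f r := by
  rw [nakagami, lintegral_withDensity_eq_lintegral_mul _
    (measurable_nakagamiPDF m 1).ennreal_ofReal hf, ← lintegral_indicator measurableSet_Ioi]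
  refine lintegral_congr_ae ?_
  have h0 : ∀ᵐ r : ℝ, r ≠ 0 := by simp [ae_iff, measure_singleton]
  filter_upwards [h0] with r hr
  rcases lt_or_gt_of_ne hr with h | h
  · rw [Set.indicator_of_notMem (by simpa using h.le)]
    simp [nakagamiPDF, not_le.2 h]
  · rw [Set.indicator_of_mem (by simpa using h)]
    rfl

lemma setLIntegral_Ioc_rpow {s ε : ℝ} (hs : 0 < s) (hε : 0 ≤ ε) :
    ∫⁻ r in Set.Ioc 0 ε, ENNReal.ofReal (r ^ (s - 1)) = ENNReal.ofReal (ε ^ s / s) := by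
  have hi : IntervalIntegrable (fun r : ℝ => r ^ (s - 1)) volume 0 ε :=
    intervalIntegral.intervalIntegrable_rpow' (by linarith)
  rw [← ofReal_integral_eq_lintegral_ofReal
    ((intervalIntegrable_iff_integrableOn_Ioc_of_le hε).1 hi), ← intervalIntegral.integral_of_le hε,
    integral_rpow (Or.inl (by linarith)), sub_add_cancel, Real.zero_rpow hs.ne', sub_zero]
  filter_upwards [ae_restrict_mem measurableSet_Ioc] with r hr
  exact Real.rpow_nonneg hr.1.le _

lemma nakagami_Iic (m ε : ℝ) : nakagami m 1 (Set.Iic ε) =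
    ∫⁻ r in Set.Ioc 0 ε, ENNReal.ofReal (nakagamiPDF m 1 r) := by
  rw [← lintegral_indicator_one measurableSet_Iic,
    lintegral_nakagami m (measurable_one.indicator measurableSet_Iic),
    ← lintegral_indicator measurableSet_Ioi, ← lintegral_indicator measurableSet_Ioc]
  refine lintegral_congr fun r => ?_
  by_cases h0 : 0 < r <;> by_cases h1 : r ≤ ε <;> simp [Set.indicator, h0, h1]

lemma ae_nakagami_pos (m : ℝ) : ∀ᵐ r ∂(nakagami m 1), 0 < r := by
  rw [ae_iff]
  have : {r : ℝ | ¬ 0 < r} = Set.Iic 0 := by ext; simp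
  rw [this, nakagami_Iic]
  simp

lemma nakagami_Iic_le {m ε : ℝ} (hm : 0 < m) (hε : 0 ≤ ε) : nakagami m 1 (Set.Iic ε) ≤
    ENNReal.ofReal (2 * m ^ m / Real.Gamma m / (2 * m)) * ENNReal.ofReal (ε ^ (2 * m)) := by
  have hK := nakagami_const_pos hm
  calc nakagami m 1 (Set.Iic ε)
      ≤ ∫⁻ r in Set.Ioc 0 ε, ENNReal.ofReal (2 * m ^ m / Real.Gamma m) *
          ENNReal.ofReal (r ^ (2 * m - 1)) := by
        rw [nakagami_Iic]
        refine setLIntegral_mono' measurableSet_Ioc fun r hr => ?_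
        rw [nakagamiPDF_one hr.1, ENNReal.ofReal_mul hK.le]
        gcongr
        refine mul_le_of_le_one_right (Real.rpow_nonneg hr.1.le _) ?_
        rw [Real.exp_le_one_iff]
        nlinarith [sq_nonneg r]
    _ = _ := by
        rw [lintegral_const_mul' _ _ ENNReal.ofReal_ne_top,
          setLIntegral_Ioc_rpow (by linarith) hε, ← ENNReal.ofReal_mul hK.le,
          ← ENNReal.ofReal_mul (by positivity)]
        congr 1
        ring

lemma le_nakagami_Iic {m ε : ℝ} (hm : 0 < m) (hε : 0 ≤ ε) (hε1 : ε ≤ 1) :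
    ENNReal.ofReal (2 * m ^ m / Real.Gamma m * Real.exp (-m) / (2 * m)) *
      ENNReal.ofReal (ε ^ (2 * m)) ≤ nakagami m 1 (Set.Iic ε) := by
  have hK := nakagami_const_pos hm
  calc _ = ∫⁻ r in Set.Ioc 0 ε, ENNReal.ofReal (2 * m ^ m / Real.Gamma m * Real.exp (-m)) *
          ENNReal.ofReal (r ^ (2 * m - 1)) := by
        rw [lintegral_const_mul' _ _ ENNReal.ofReal_ne_top,
          setLIntegral_Ioc_rpow (by linarith) hε, ← ENNReal.ofReal_mul (by positivity),
          ← ENNReal.ofReal_mul (by positivity)]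
        congr 1
        ring
    _ ≤ _ := by
        rw [nakagami_Iic]
        refine setLIntegral_mono' measurableSet_Ioc fun r hr => ?_
        rw [nakagamiPDF_one hr.1, ← ENNReal.ofReal_mul (by positivity), mul_assoc,
          mul_comm (Real.exp _)]
        have hr0 := Real.rpow_nonneg hr.1.le (2 * m - 1)
        have hexp : Real.exp (-m) ≤ Real.exp (-m * r ^ 2) := by
          rw [Real.exp_le_exp]
          have : r ^ 2 ≤ 1 := pow_le_one₀ hr.1.le (hr.2.trans hε1)
          nlinarith
        gcongr

/-- The negative moments of order below `2m` of the Nakagami law are finite. -/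
lemma lintegral_nakagami_rpow_neg_ne_top {m a : ℝ} (hm : 0 < m) (ha : a < 2 * m) :
    ∫⁻ r, ENNReal.ofReal (r ^ (-a)) ∂(nakagami m 1) ≠ ⊤ := by
  have hi := (integrableOn_rpow_mul_exp_neg_mul_sq hm
    (s := 2 * m - 1 - a) (by linarith)).const_mul (2 * m ^ m / Real.Gamma m)
  rw [lintegral_nakagami m (by fun_prop)]
  refine ne_of_lt (lt_of_eq_of_lt ?_ hi.lintegral_lt_top)
  refine setLIntegral_congr_fun measurableSet_Ioi fun r hr => ?_
  have hr' : 0 < r := hr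
  rw [← ENNReal.ofReal_mul' (Real.rpow_nonneg hr'.le _), nakagamiPDF_one hr',
    sub_eq_add_neg _ a, Real.rpow_add hr']
  congr 1
  ring

/-- The moments of the norm of the complex Gaussian are finite. -/
lemma lintegral_norm_rpow_stdComplexGaussian_ne_top {a : ℝ} (ha : 0 < a) :
    ∫⁻ w, ENNReal.ofReal (‖w‖ ^ a) ∂stdComplexGaussian ≠ ⊤ := by
  have hi : Integrable fun w : ℂ => ‖w‖ ^ a * Real.exp (-‖w‖ ^ (2 : ℝ)) := by
    by_contra h
    have h1 := Complex.integral_rpow_mul_exp_neg_rpow (p := 2) (q := a) (by norm_num) (by linarith)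
    rw [integral_undef h] at h1
    have := Real.Gamma_pos_of_pos (s := (a + 2) / 2) (by linarith)
    have : 0 < 2 * Real.pi / 2 * Real.Gamma ((a + 2) / 2) := by positivity
    linarith
  rw [stdComplexGaussian, lintegral_withDensity_eq_lintegral_mul _ (by fun_prop) (by fun_prop)]
  refine ne_of_lt (lt_of_eq_of_lt ?_ (hi.const_mul (1 / Real.pi)).lintegral_lt_top)
  refine lintegral_congr fun w => ?_
  rw [Pi.mul_apply, ← ENNReal.ofReal_mul (by positivity), Real.rpow_two]
  congr 1
  ring

lemma stdComplexGaussian_ball_ne_zero (q : ℂ) : stdComplexGaussian (Metric.ball q 1) ≠ 0 := by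
  intro h
  rw [stdComplexGaussian, withDensity_apply_eq_zero (by fun_prop)] at h
  have h2 : {w : ℂ | ENNReal.ofReal (1 / Real.pi * Real.exp (-‖w‖ ^ 2)) ≠ 0} = Set.univ := by
    ext w
    simp only [Set.mem_ofPred_eq, Set.mem_univ, iff_true, ne_eq, ENNReal.ofReal_eq_zero, not_le]
    have := Real.pi_pos
    positivity
  rw [h2, Set.univ_inter] at h
  exact (Metric.measure_ball_pos volume q one_pos).ne' h

lemma exists_le_stdComplexGaussian_openSector {n : ℕ} (hn : 1 ≤ n) (k : ℕ) :
    ∃ c : ENNReal, c ≠ 0 ∧ ∀ d : ℂ, ‖d‖ ≤ 1 →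
      c ≤ stdComplexGaussian {w | d + w ∈ openSector n k} := by
  obtain ⟨q, hq⟩ := exists_ball_subset_openSector hn k
  refine ⟨_, stdComplexGaussian_ball_ne_zero q, fun d hd => measure_mono fun w hw => hq _ ?_⟩
  rw [Metric.mem_ball, dist_eq_norm] at hw
  calc ‖d + w - q‖ = ‖d + (w - q)‖ := by rw [add_sub_assoc]
    _ ≤ ‖d‖ + ‖w - q‖ := norm_add_le _ _
    _ < 2 := by linarith

/-- Angles at which the sine is at most `t` lie within `πt/2` of `0` or `±π`. -/
lemma volume_abs_sin_le {t : ℝ} (ht : 0 ≤ t) :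
    volume (Set.Ioc (-Real.pi) Real.pi ∩ {θ | |Real.sin θ| ≤ t}) ≤
      ENNReal.ofReal (2 * Real.pi * t) := by
  have hpi := Real.pi_pos
  have hsub : Set.Ioc (-Real.pi) Real.pi ∩ {θ | |Real.sin θ| ≤ t} ⊆
      Set.Icc (-(Real.pi * t / 2)) (Real.pi * t / 2) ∪
        (Set.Icc (Real.pi - Real.pi * t / 2) Real.pi ∪
          Set.Icc (-Real.pi) (-Real.pi + Real.pi * t / 2)) := by
    -- Jordan's inequality `2/π x ≤ sin x` on each quarter
    have hj : ∀ x, 0 ≤ x → x ≤ Real.pi / 2 → |Real.sin x| ≤ t → x ≤ Real.pi * t / 2 := by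
      intro x h0 h1 h
      have h2 := (Real.mul_le_sin h0 h1).trans ((le_abs_self _).trans h)
      rw [div_mul_eq_mul_div, div_le_iff₀ hpi] at h2
      linarith
    rintro θ ⟨⟨h1, h2⟩, h3⟩
    have h3' : |Real.sin θ| ≤ t := h3
    simp only [Set.mem_union, Set.mem_Icc]
    rcases le_total 0 θ with h0 | h0
    · rcases le_total θ (Real.pi / 2) with h | h
      · exact Or.inl ⟨by nlinarith, hj θ h0 h h3'⟩
      · have := hj (Real.pi - θ) (by linarith) (by linarith) (by rwa [Real.sin_pi_sub])
        exact Or.inr (Or.inl ⟨by linarith, h2⟩)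
    · rcases le_total (-θ) (Real.pi / 2) with h | h
      · have := hj (-θ) (by linarith) h (by rwa [Real.sin_neg, abs_neg])
        exact Or.inl ⟨by linarith, by nlinarith⟩
      · have := hj (Real.pi + θ) (by linarith) (by linarith)
          (by rwa [add_comm, Real.sin_add_pi, abs_neg])
        exact Or.inr (Or.inr ⟨h1.le, by linarith⟩)
  refine (measure_mono hsub).trans ((measure_union_le _ _).trans
    ((add_le_add le_rfl (measure_union_le _ _)).trans ?_))
  simp only [Real.volume_Icc]
  rw [← ENNReal.ofReal_add (by nlinarith) (by nlinarith), ← ENNReal.ofReal_add (by nlinarith)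
    (by nlinarith)]
  exact ENNReal.ofReal_le_ofReal (by linarith)

lemma setLIntegral_rotation (f : ℂ → ENNReal) (h : ℂ) :
    ∫⁻ θ in Set.Ioc (-Real.pi) Real.pi, f (Complex.exp (Complex.I * (θ : ℂ)) * h) =
      ∫⁻ θ in Set.Ioc (-Real.pi) Real.pi, f (Complex.exp (Complex.I * (θ : ℂ)) * (‖h‖ : ℂ)) := by
  set φ := Complex.arg h
  set F : ℝ → ENNReal := fun θ => f (Complex.exp (Complex.I * (θ : ℂ)) * (‖h‖ : ℂ)) with hF
  have h1 : ∀ θ : ℝ, f (Complex.exp (Complex.I * (θ : ℂ)) * h) = F (θ + φ) := by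
    intro θ
    rw [hF]
    dsimp only
    conv_lhs => rw [← Complex.norm_mul_exp_arg_mul_I h]
    rw [Complex.ofReal_add, mul_add, Complex.exp_add, mul_comm _ Complex.I]
    ring_nf
    rfl
  have hper : ∀ (g : AddSubgroup.zmultiples (2 * Real.pi)) (x : ℝ), F (g +ᵥ x) = F x := by
    rintro ⟨g, k, rfl⟩ x
    rw [hF]
    dsimp only
    congr 2
    rw [Complex.exp_eq_exp_iff_exists_int]
    refine ⟨k, ?_⟩
    simp only [AddSubgroup.vadd_def, vadd_eq_add, zsmul_eq_mul]
    push_cast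
    ring
  have h2 : ∫⁻ θ in Set.Ioc (-Real.pi) Real.pi, F (θ + φ) =
      ∫⁻ θ in Set.Ioc (-Real.pi + φ) (Real.pi + φ), F θ := by
    rw [← (measurePreserving_add_right volume φ).setLIntegral_comp_preimage_emb
      (measurableEmbedding_addRight φ) F]
    congr 2
    ext θ
    simp
  simp_rw [h1]
  rw [h2]
  have e1 := isAddFundamentalDomain_Ioc Real.two_pi_pos (-Real.pi + φ) volume
  have e2 := isAddFundamentalDomain_Ioc Real.two_pi_pos (-Real.pi) volume
  have := e1.setLIntegral_eq e2 F hper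
  rwa [show -Real.pi + φ + 2 * Real.pi = Real.pi + φ by ring,
    show -Real.pi + 2 * Real.pi = Real.pi by ring] at this

namespace IsFadingPSKModel

variable {Ω : Type*} [MeasurableSpace Ω] {P : Measure Ω} {M : ℕ} {m : ℝ}
  {X H W : Ω → ℂ}

lemma map_H_norm_le (hmodel : IsFadingPSKModel P M m X H W) (ε : ℝ) :
    P.map H {h | ‖h‖ ≤ ε} = nakagami m 1 (Set.Iic ε) := by
  rw [← hmodel.H_magnitude, Measure.map_apply hmodel.measurable_H.norm measurableSet_Iic,
    Measure.map_apply hmodel.measurable_H (measurableSet_le measurable_norm measurable_const)]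
  rfl

lemma map_H_mul (hmodel : IsFadingPSKModel P M m X H W) {v : ℂ} (hv : ‖v‖ = 1) {S : Set ℂ}
    (hS : MeasurableSet S) : P.map H {h | v * h ∈ S} = P.map H S := by
  have hH := hmodel.measurable_H
  have h := hmodel.H_circular v.arg
  have hve : Complex.exp (Complex.I * (v.arg : ℂ)) = v := by
    have := Complex.norm_mul_exp_arg_mul_I v
    rwa [hv, Complex.ofReal_one, one_mul, mul_comm] at this
  rw [hve] at h
  conv_rhs => rw [← h, Measure.map_apply (hH.const_mul v) hS]
  exact Measure.map_apply hH (hS.preimage (measurable_const_mul v))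

variable [IsProbabilityMeasure P]

/-- The fading coefficient has a uniform phase that is independent of its magnitude. -/
lemma lintegral_map_H (hmodel : IsFadingPSKModel P M m X H W) {f : ℂ → ENNReal}
    (hf : Measurable f) :
    ENNReal.ofReal (2 * Real.pi) * ∫⁻ h, f h ∂(P.map H) =
      ∫⁻ r : ℝ, (∫⁻ θ in Set.Ioc (-Real.pi) Real.pi,
        f (Complex.exp (Complex.I * (θ : ℂ)) * (r : ℂ))) ∂(nakagami m 1) := by
  have hH := hmodel.measurable_H
  have hrot : ∀ θ : ℝ, ∫⁻ h, f (Complex.exp (Complex.I * (θ : ℂ)) * h) ∂(P.map H) =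
      ∫⁻ h, f h ∂(P.map H) := by
    intro θ
    conv_rhs => rw [← hmodel.H_circular θ]
    rw [lintegral_map (by fun_prop) hH, lintegral_map hf (by fun_prop)]
  have hvol : volume (Set.Ioc (-Real.pi) Real.pi) = ENNReal.ofReal (2 * Real.pi) := by
    rw [Real.volume_Ioc]; congr 1; ring
  calc _ = ∫⁻ θ in Set.Ioc (-Real.pi) Real.pi,
        ∫⁻ h, f (Complex.exp (Complex.I * (θ : ℂ)) * h) ∂(P.map H) := by
        simp_rw [hrot]
        rw [setLIntegral_const, hvol, mul_comm]
    _ = ∫⁻ h, (∫⁻ θ in Set.Ioc (-Real.pi) Real.pi,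
        f (Complex.exp (Complex.I * (θ : ℂ)) * h)) ∂(P.map H) := by
        have : IsProbabilityMeasure (P.map H) := Measure.isProbabilityMeasure_map hH.aemeasurable
        exact lintegral_lintegral_swap (by
          have : Measurable (Function.uncurry fun (θ : ℝ) (h : ℂ) =>
              f (Complex.exp (Complex.I * (θ : ℂ)) * h)) := by
            unfold Function.uncurry; fun_prop
          exact this.aemeasurable)
    _ = ∫⁻ h, (∫⁻ θ in Set.Ioc (-Real.pi) Real.pi,
        f (Complex.exp (Complex.I * (θ : ℂ)) * (‖h‖ : ℂ))) ∂(P.map H) := by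
        exact lintegral_congr fun h => setLIntegral_rotation f h
    _ = _ := by
        have hm2 : Measurable (fun p : ℝ × ℝ =>
            f (Complex.exp (Complex.I * (p.2 : ℂ)) * (p.1 : ℂ))) := by fun_prop
        have hm1 := hm2.lintegral_prod_right' (ν := volume.restrict (Set.Ioc (-Real.pi) Real.pi))
        dsimp only at hm1
        rw [← hmodel.H_magnitude, lintegral_map hm1 hH.norm]
        exact lintegral_map (hm1.comp measurable_norm) hH

/-- The fading coefficient is close to a given line with probability almost linear in the
distance. -/
lemma map_H_abs_im_le (hmodel : IsFadingPSKModel P M m X H W) {a : ℝ} (ha : 0 < a) (ha1 : a < 1)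
    {ε : ℝ} (hε : 0 ≤ ε) :
    P.map H {h | |h.im| ≤ ε} ≤
      (∫⁻ r, ENNReal.ofReal (r ^ (-a)) ∂(nakagami m 1)) * ENNReal.ofReal (ε ^ a) := by
  have hpi := Real.pi_pos
  have hS : MeasurableSet {h : ℂ | |h.im| ≤ ε} := measurableSet_le (by fun_prop) measurable_const
  have hpos := ae_nakagami_pos m
  have h := hmodel.lintegral_map_H (measurable_one.indicator hS)
  rw [lintegral_indicator_one hS] at h
  have h2pi : ENNReal.ofReal (2 * Real.pi) ≠ 0 := by simpa using hpi
  rw [← ENNReal.mul_le_mul_iff_right h2pi ENNReal.ofReal_ne_top, h, ← mul_assoc,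
    ← lintegral_const_mul _ (by fun_prop), ← lintegral_mul_const _ (by fun_prop)]
  refine lintegral_mono_ae ?_
  filter_upwards [hpos] with r hr
  have ht : 0 ≤ ε / r := by positivity
  have hset : ∫⁻ θ in Set.Ioc (-Real.pi) Real.pi,
      {h : ℂ | |h.im| ≤ ε}.indicator 1 (Complex.exp (Complex.I * (θ : ℂ)) * (r : ℂ)) =
      volume (Set.Ioc (-Real.pi) Real.pi ∩ {θ | |Real.sin θ| ≤ ε / r}) := by
    have hSt : MeasurableSet {θ : ℝ | |Real.sin θ| ≤ ε / r} :=
      measurableSet_le (by fun_prop) measurable_const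
    rw [Set.inter_comm, ← Measure.restrict_apply hSt, ← lintegral_indicator_one hSt]
    refine lintegral_congr fun θ => ?_
    have him : (Complex.exp (Complex.I * (θ : ℂ)) * (r : ℂ)).im = r * Real.sin θ := by
      rw [mul_comm, mul_comm Complex.I, Complex.im_ofReal_mul, Complex.exp_ofReal_mul_I_im]
    simp only [Set.indicator, Set.mem_ofPred_eq, him, abs_mul, abs_of_pos hr, le_div_iff₀ hr,
      mul_comm r, Pi.one_apply]
  rw [hset, mul_assoc, ← ENNReal.ofReal_mul (by positivity), Real.rpow_neg hr.le,
    inv_mul_eq_div, ← Real.div_rpow hε hr.le, ← ENNReal.ofReal_mul (by positivity)]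
  rcases le_total (ε / r) 1 with h1 | h1
  · refine (volume_abs_sin_le ht).trans (ENNReal.ofReal_le_ofReal ?_)
    gcongr
    exact Real.self_le_rpow_of_le_one ht h1 ha1.le
  · refine (measure_mono Set.inter_subset_left).trans ?_
    rw [Real.volume_Ioc]
    refine ENNReal.ofReal_le_ofReal ?_
    have := Real.one_le_rpow h1 ha.le
    nlinarith

lemma le_map_H_abs_im_le (hmodel : IsFadingPSKModel P M m X H W) {ε : ℝ} (hε : 0 ≤ ε)
    (hε1 : ε ≤ 1) :
    ENNReal.ofReal ε * nakagami m 1 (Set.Iic 1) ≤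
      ENNReal.ofReal (2 * Real.pi) * P.map H {h | |h.im| ≤ ε ∧ 0 ≤ h.re} := by
  have hpi := Real.pi_gt_three
  have hS : MeasurableSet {h : ℂ | |h.im| ≤ ε ∧ 0 ≤ h.re} :=
    (measurableSet_le (by fun_prop : Measurable fun h : ℂ => |h.im|) measurable_const).inter
      (measurableSet_le measurable_const Complex.measurable_re)
  have hpos := ae_nakagami_pos m
  rw [← lintegral_indicator_one hS, hmodel.lintegral_map_H (measurable_one.indicator hS),
    ← setLIntegral_const]
  refine le_trans ?_ (setLIntegral_le_lintegral (Set.Iic 1) _)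
  refine lintegral_mono_ae ?_
  filter_upwards [ae_restrict_mem measurableSet_Iic, ae_restrict_of_ae hpos] with r hr1 hr0
  have hr1' : r ≤ 1 := hr1
  calc ENNReal.ofReal ε = ∫⁻ θ in Set.Ioc 0 ε, 1 := by
        rw [setLIntegral_one, Real.volume_Ioc, sub_zero]
    _ ≤ ∫⁻ θ in Set.Ioc 0 ε, {h : ℂ | |h.im| ≤ ε ∧ 0 ≤ h.re}.indicator 1
          (Complex.exp (Complex.I * (θ : ℂ)) * (r : ℂ)) := by
        refine setLIntegral_mono' measurableSet_Ioc fun θ hθ => ?_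
        have him : (Complex.exp (Complex.I * (θ : ℂ)) * (r : ℂ)).im = r * Real.sin θ := by
          rw [mul_comm, mul_comm Complex.I, Complex.im_ofReal_mul, Complex.exp_ofReal_mul_I_im]
        have hre : (Complex.exp (Complex.I * (θ : ℂ)) * (r : ℂ)).re = r * Real.cos θ := by
          rw [mul_comm, mul_comm Complex.I, Complex.re_ofReal_mul, Complex.exp_ofReal_mul_I_re]
        rw [Set.indicator_of_mem, Pi.one_apply]
        have hsin0 : 0 ≤ Real.sin θ :=
          Real.sin_nonneg_of_nonneg_of_le_pi hθ.1.le (by linarith [hθ.2])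
        have hsin1 := Real.sin_le hθ.1.le
        refine ⟨?_, ?_⟩
        · rw [him, abs_of_nonneg (by positivity)]
          nlinarith [hθ.2]
        · rw [hre]
          exact mul_nonneg hr0.le (Real.cos_nonneg_of_neg_pi_div_two_le_of_le
            (by linarith [hθ.1]) (by linarith [hθ.2]))
    _ ≤ _ := by
        refine lintegral_mono_set (Set.Ioc_subset_Ioc (by linarith) (by linarith))

/-- If `f(H)` is at most `ε` with probability `O(εᵃ)`, the noise exceeds `t f(H)` with probability
`O(t⁻ᵃ)`: average over the noise, whose moments are finite. -/
lemma exists_measure_le_norm_W_le (hmodel : IsFadingPSKModel P M m X H W) {f : ℂ → ℝ}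
    (hf : Measurable f) {a : ℝ} (ha : 0 < a) {C : ENNReal} (hC : C ≠ ⊤)
    (hfC : ∀ ε, 0 ≤ ε → P.map H {h | f h ≤ ε} ≤ C * ENNReal.ofReal (ε ^ a)) :
    ∃ K : ℝ, ∀ t, 0 < t → P.real {ω | t * f (H ω) ≤ ‖W ω‖} ≤ K * t ^ (-a) := by
  have hE := lintegral_norm_rpow_stdComplexGaussian_ne_top ha
  set E := ∫⁻ w, ENNReal.ofReal (‖w‖ ^ a) ∂stdComplexGaussian
  refine ⟨(C * E).toReal, fun t ht => ?_⟩
  have hT : MeasurableSet {p : ℂ × ℂ | t * f p.1 ≤ ‖p.2‖} :=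
    measurableSet_le (by fun_prop) (by fun_prop)
  have hle : P {ω | t * f (H ω) ≤ ‖W ω‖} ≤ C * E * ENNReal.ofReal (t ^ (-a)) := by
    calc P {ω | t * f (H ω) ≤ ‖W ω‖}
        = ∫⁻ w, P.map H {h | t * f h ≤ ‖w‖} ∂stdComplexGaussian := hmodel.measure_prodMk_mem' hT
      _ ≤ ∫⁻ w, C * ENNReal.ofReal (t ^ (-a)) * ENNReal.ofReal (‖w‖ ^ a) ∂stdComplexGaussian := by
          refine lintegral_mono fun w => ?_
          have h := hfC (‖w‖ / t) (by positivity)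
          rw [Real.div_rpow (norm_nonneg _) ht.le, ← inv_mul_eq_div (t ^ a), ← Real.rpow_neg ht.le,
            ENNReal.ofReal_mul (by positivity), ← mul_assoc] at h
          refine le_trans (le_of_eq ?_) h
          simp_rw [le_div_iff₀ ht, mul_comm t]
      _ = _ := by
          rw [lintegral_const_mul' _ _ (by finiteness)]
          ring
  have := ENNReal.toReal_mono (by finiteness) hle
  rwa [ENNReal.toReal_mul, ENNReal.toReal_ofReal (by positivity)] at this

end IsFadingPSKModel

end PhaseQuant

/-! ### Bounds on the symbol error probability -/

namespace PhaseQuant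

/-- Polynomial bounds of order `-d` from below and of every order `-a > -d` from above determine
the diversity order. -/
lemma hasDiversityOrder_of_bounds {p : ℝ → ℝ} {d : ℝ} {b : ENNReal} (hd : 0 < d) (hb : b ≠ 0)
    (hlow : ∀ᶠ snr in atTop, b * ENNReal.ofReal (snr ^ (-d)) ≤ ENNReal.ofReal (p snr))
    (hup : ∀ a, 0 < a → a < d → ∃ K : ℝ, ∀ᶠ snr in atTop, p snr ≤ K * snr ^ (-a)) :
    HasDiversityOrder p d := by
  obtain ⟨c, hc, hlow'⟩ : ∃ c : ℝ, 0 < c ∧ ∀ᶠ snr in atTop, c * snr ^ (-d) ≤ p snr := by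
    have hb1 : min b 1 ≠ ⊤ := ne_top_of_le_ne_top ENNReal.one_ne_top (min_le_right _ _)
    have hc : 0 < (min b 1).toReal :=
      ENNReal.toReal_pos (lt_min (pos_iff_ne_zero.2 hb) one_pos).ne' hb1
    refine ⟨(min b 1).toReal, hc, ?_⟩
    filter_upwards [hlow, eventually_gt_atTop 0] with snr h h0
    have hle : ENNReal.ofReal ((min b 1).toReal * snr ^ (-d)) ≤ ENNReal.ofReal (p snr) := by
      rw [ENNReal.ofReal_mul hc.le, ENNReal.ofReal_toReal hb1]
      exact le_trans (by gcongr; exact min_le_left _ _) h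
    have hpos : 0 < (min b 1).toReal * snr ^ (-d) := by positivity
    rcases ENNReal.ofReal_le_ofReal_iff'.1 hle with h | h
    · exact h
    · linarith
  have hlog := Real.tendsto_log_atTop
  rw [HasDiversityOrder, tendsto_order]
  constructor
  · intro a₀ ha₀
    obtain ⟨a, ha1, ha2⟩ := exists_between (max_lt ha₀ hd)
    obtain ⟨K, hK⟩ := hup a ((le_max_right _ _).trans_lt ha1) ha2
    have ha3 : 0 < a - a₀ := by linarith [(le_max_left a₀ 0).trans_lt ha1]
    filter_upwards [hK, hlow', eventually_gt_atTop 1,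
      hlog.eventually_gt_atTop (Real.log K / (a - a₀))] with snr h1 h2 h3 h4
    have h0 : 0 < snr := by linarith
    have hl : 0 < Real.log snr := Real.log_pos h3
    have hp : 0 < p snr := lt_of_lt_of_le (by positivity) h2
    have hKpos : 0 < K := pos_of_mul_pos_left (hp.trans_le h1) (by positivity)
    have h5 := Real.log_le_log hp h1
    rw [Real.log_mul hKpos.ne' (by positivity), Real.log_rpow h0] at h5
    rw [div_lt_iff₀ ha3] at h4
    rw [← neg_div, lt_div_iff₀ hl]
    nlinarith
  · intro a₀ ha₀
    have ha3 : 0 < a₀ - d := by linarith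
    filter_upwards [hlow', eventually_gt_atTop 1,
      hlog.eventually_gt_atTop (-Real.log c / (a₀ - d))] with snr h2 h3 h4
    have h0 : 0 < snr := by linarith
    have hl : 0 < Real.log snr := Real.log_pos h3
    have h5 := Real.log_le_log (by positivity) h2
    rw [Real.log_mul hc.ne' (by positivity), Real.log_rpow h0] at h5
    rw [div_lt_iff₀ ha3] at h4
    rw [← neg_div, div_lt_iff₀ hl]
    nlinarith

lemma sqrt_rpow_neg {snr : ℝ} (hsnr : 0 ≤ snr) (a : ℝ) :
    Real.sqrt snr ^ (-a) = snr ^ (-(a / 2)) := by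
  rw [Real.sqrt_eq_rpow, ← Real.rpow_mul hsnr]
  congr 1
  ring

/-- Two neighbouring points of the constellation. -/
lemma exists_neighbours_constellation {M : ℕ} (hM : 2 ≤ M) :
    ∃ x ∈ constellation M, x * Complex.exp (((2 * Real.pi / M : ℝ) : ℂ) * Complex.I) ∈
      constellation M ∧ x ≠ x * Complex.exp (((2 * Real.pi / M : ℝ) : ℂ) * Complex.I) := by
  have hM0 : (M : ℂ) ≠ 0 := by exact_mod_cast (by omega : M ≠ 0)
  have hpi : (Real.pi : ℂ) ≠ 0 := by exact_mod_cast Real.pi_ne_zero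
  refine ⟨_, ⟨⟨0, by omega⟩, rfl⟩, ⟨⟨1, by omega⟩, ?_⟩, ?_⟩
  · dsimp only
    rw [← Complex.exp_add]
    congr 1
    push_cast
    field_simp
    ring
  · intro h
    have h1 := mul_left_cancel₀ (Complex.exp_ne_zero _) ((mul_one _).trans h)
    obtain ⟨k, hk⟩ := Complex.exp_eq_one_iff.1 h1.symm
    have h2 : (1 : ℂ) = k * M := by
      push_cast at hk
      field_simp at hk
      have := Complex.I_ne_zero
      linear_combination hk
    have h3 : (1 : ℤ) = k * M := by exact_mod_cast h2
    have := Int.eq_one_or_neg_one_of_mul_eq_one' h3.symm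
    omega

lemma measurableSet_prod_of_slices {n : ℕ} {S : Set (Fin (2 ^ n) × ℂ)}
    (hS : ∀ k, MeasurableSet {h | (k, h) ∈ S}) : MeasurableSet S := by
  have : S = ⋃ k, {k} ×ˢ {h | (k, h) ∈ S} := by
    ext ⟨k, h⟩
    simp
  rw [this]
  exact MeasurableSet.iUnion fun k => (measurableSet_singleton k).prod (hS k)

namespace IsFadingPSKModel

variable {Ω : Type*} [MeasurableSpace Ω] {P : Measure Ω} [IsProbabilityMeasure P] {M n : ℕ}
  {m : ℝ} {X H W : Ω → ℂ} {xhat : ℝ → Fin (2 ^ n) × ℂ → ℂ}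

/-- A deep fade, `‖√SNR H‖ ≤ 1`, makes every detector fail with positive probability. -/
lemma exists_le_symbolErrorProb_of_deep_fade (hmodel : IsFadingPSKModel P M m X H W)
    (hM : 2 ≤ M) (hn : 1 ≤ n) (hm : 0 < m) (hxhat : ∀ snr, 0 < snr → Measurable (xhat snr)) :
    ∃ b : ENNReal, b ≠ 0 ∧ ∀ᶠ snr in atTop, b * ENNReal.ofReal (snr ^ (-m)) ≤
      ENNReal.ofReal (symbolErrorProb P n X H W snr (xhat snr)) := by
  obtain ⟨x, hx, hx', hne⟩ := exists_neighbours_constellation hM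
  obtain ⟨c, hc0, hc⟩ := exists_le_stdComplexGaussian_openSector hn 0
  have hG : 0 < 2 * m ^ m / Real.Gamma m * Real.exp (-m) / (2 * m) := by
    have := nakagami_const_pos hm
    positivity
  refine ⟨(M : ENNReal)⁻¹ * (c * ENNReal.ofReal
    (2 * m ^ m / Real.Gamma m * Real.exp (-m) / (2 * m))), ?_, ?_⟩
  · have : ENNReal.ofReal (2 * m ^ m / Real.Gamma m * Real.exp (-m) / (2 * m)) ≠ 0 := by
      simpa using hG
    simp [hc0, this]
  filter_upwards [eventually_ge_atTop 1] with snr hsnr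
  have h0 : 0 < snr := by linarith
  have hs : 0 < Real.sqrt snr := Real.sqrt_pos.2 h0
  have hs1 : 1 ≤ Real.sqrt snr := Real.one_le_sqrt.2 hsnr
  have hB : MeasurableSet {h : ℂ | ‖h‖ ≤ (Real.sqrt snr)⁻¹} :=
    measurableSet_le measurable_norm measurable_const
  have hkey : ∀ y ∈ constellation M, ∀ h ∈ {h : ℂ | ‖h‖ ≤ (Real.sqrt snr)⁻¹},
      c ≤ stdComplexGaussian
        {w | (Real.sqrt snr : ℂ) * h * y + w ∈ region n ⟨0, by positivity⟩} := by
    intro y hy h hh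
    refine (hc ((Real.sqrt snr : ℂ) * h * y) ?_).trans
      (measure_mono fun w hw => openSector_subset_region hn _ hw)
    rw [norm_mul, norm_mul, norm_of_mem_constellation hy, mul_one, Complex.norm_real,
      Real.norm_of_nonneg hs.le]
    calc Real.sqrt snr * ‖h‖ ≤ Real.sqrt snr * (Real.sqrt snr)⁻¹ := by gcongr; exact hh
      _ = 1 := mul_inv_cancel₀ hs.ne'
  have h1 := hmodel.le_measure_ne_detector (hxhat snr h0) hx hx' hne _ hB (hkey _ hx) (hkey _ hx')
  rw [symbolErrorProb, ofReal_measureReal]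
  refine le_trans ?_ h1
  rw [hmodel.map_H_norm_le, mul_assoc, mul_assoc]
  have h2 := le_nakagami_Iic hm (inv_nonneg.2 hs.le) (inv_le_one_of_one_le₀ hs1)
  rw [Real.inv_rpow hs.le, ← Real.rpow_neg hs.le, sqrt_rpow_neg h0.le,
    mul_div_cancel_left₀ _ two_ne_zero] at h2
  gcongr

/-- With `2ⁿ = M` cones, a rotated constellation at distance `O(1)` from the boundary rays of the
cones makes every detector fail with positive probability. -/
lemma exists_le_symbolErrorProb_of_alignment (hmodel : IsFadingPSKModel P M m X H W)
    (hM : 2 ≤ M) (hn : 1 ≤ n) (hMn : M = 2 ^ n) (hm : 0 < m)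
    (hxhat : ∀ snr, 0 < snr → Measurable (xhat snr)) :
    ∃ b : ENNReal, b ≠ 0 ∧ ∀ᶠ snr in atTop, b * ENNReal.ofReal (snr ^ (-(1 / 2 : ℝ))) ≤
      ENNReal.ofReal (symbolErrorProb P n X H W snr (xhat snr)) := by
  obtain ⟨x, hx, hx', hne⟩ := exists_neighbours_constellation hM
  obtain ⟨c, hc0, hc⟩ := exists_le_stdComplexGaussian_openSector hn 0
  have hν : nakagami m 1 (Set.Iic 1) ≠ 0 := by
    have hG : 0 < 2 * m ^ m / Real.Gamma m * Real.exp (-m) / (2 * m) := by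
      have := nakagami_const_pos hm
      positivity
    have h := le_nakagami_Iic hm zero_le_one le_rfl
    rw [Real.one_rpow, ENNReal.ofReal_one, mul_one] at h
    exact (lt_of_lt_of_le (ENNReal.ofReal_pos.2 hG) h).ne'
  have h2pi : ENNReal.ofReal (2 * Real.pi) ≠ 0 := by simpa using Real.pi_pos
  refine ⟨(M : ENNReal)⁻¹ * (c * ((ENNReal.ofReal (2 * Real.pi))⁻¹ * nakagami m 1 (Set.Iic 1))),
    ?_, ?_⟩
  · have := ENNReal.inv_ne_zero.2 (ENNReal.ofReal_ne_top (r := 2 * Real.pi))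
    exact mul_ne_zero (by simp) (mul_ne_zero hc0 (mul_ne_zero this hν))
  filter_upwards [eventually_ge_atTop 1] with snr hsnr
  have h0 : 0 < snr := by linarith
  have hs : 0 < Real.sqrt snr := Real.sqrt_pos.2 h0
  have hs1 : 1 ≤ Real.sqrt snr := Real.one_le_sqrt.2 hsnr
  set S : Set ℂ := {h : ℂ | |h.im| ≤ (Real.sqrt snr)⁻¹ ∧ 0 ≤ h.re} with hS_def
  have hS : MeasurableSet S :=
    (measurableSet_le (by fun_prop : Measurable fun h : ℂ => |h.im|) measurable_const).inter
      (measurableSet_le measurable_const Complex.measurable_re)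
  -- the coordinate of `h x` along the boundary ray of index `0`
  set u := boundaryRay n 0 with hu
  set e := Complex.exp (((2 * Real.pi / M : ℝ) : ℂ) * Complex.I) with he
  have hu1 : ‖u‖ = 1 := norm_boundaryRay n 0
  have he1 : ‖e‖ = 1 := Complex.norm_exp_ofReal_mul_I _
  set v := (starRingEnd ℂ) u * x with hv
  have hv1 : ‖v‖ = 1 := by
    rw [hv, norm_mul, RCLike.norm_conj, hu1, norm_of_mem_constellation hx, one_mul]
  have huu : u * (starRingEnd ℂ) u = 1 := by
    rw [Complex.mul_conj, Complex.normSq_eq_norm_sq, hu1]; simp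
  have hue : boundaryRay n (0 + 1) = u * e := by
    rw [boundaryRay_add, he, hMn]
    push_cast
    rw [mul_one]
  have hdec : ∀ h : ℂ, (Real.sqrt snr : ℂ) * h * x =
      ((Real.sqrt snr * (v * h).re : ℝ) : ℂ) * u +
        ((Real.sqrt snr * (v * h).im : ℝ) : ℂ) * (Complex.I * u) := by
    intro h
    have h1 : h * x = (v * h) * u := by rw [hv]; linear_combination -(h * x) * huu
    rw [mul_assoc, h1]
    conv_lhs => rw [← Complex.re_add_im (v * h)]
    push_cast
    ring
  have hd : ∀ h : ℂ, v * h ∈ S →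
      ‖((Real.sqrt snr * (v * h).im : ℝ) : ℂ) * (Complex.I * u)‖ ≤ 1 := by
    intro h hh
    rw [norm_mul, norm_mul, hu1, Complex.norm_I, mul_one, mul_one, Complex.norm_real,
      Real.norm_eq_abs, abs_mul, abs_of_pos hs]
    calc Real.sqrt snr * |(v * h).im| ≤ Real.sqrt snr * (Real.sqrt snr)⁻¹ := by
          gcongr; exact hh.1
      _ = 1 := mul_inv_cancel₀ hs.ne'
  have hB : MeasurableSet {h | v * h ∈ S} := hS.preimage (measurable_const_mul v)
  have h1 := hmodel.le_measure_ne_detector (snr := snr) (hxhat snr h0) hx hx' hne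
    ⟨0, by positivity⟩ hB (c := c)
    (by
      intro h hh
      refine (hc _ (hd h hh)).trans (measure_mono fun w hw => openSector_subset_region hn _ ?_)
      rw [hdec, add_assoc]
      exact add_boundaryRay_mem_openSector hn 0 (mul_nonneg hs.le hh.2) hw)
    (by
      intro h hh
      refine (hc (((Real.sqrt snr * (v * h).im : ℝ) : ℂ) * (Complex.I * u) * e) ?_).trans
        (measure_mono fun w hw => openSector_subset_region hn _ ?_)
      · rw [norm_mul, he1, mul_one]
        exact hd h hh
      · rw [← mul_assoc, hdec, add_mul, add_assoc, mul_assoc _ u, ← hue]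
        exact add_boundaryRay_succ_mem_openSector hn 0 (mul_nonneg hs.le hh.2) hw)
  rw [symbolErrorProb, ofReal_measureReal]
  refine le_trans ?_ h1
  rw [hmodel.map_H_mul hv1 hS, mul_assoc, mul_assoc]
  have h2 := hmodel.le_map_H_abs_im_le (inv_nonneg.2 hs.le) (inv_le_one_of_one_le₀ hs1)
  have h3 : snr ^ (-(1 / 2 : ℝ)) = (Real.sqrt snr)⁻¹ := by
    rw [Real.sqrt_eq_rpow, Real.rpow_neg h0.le]
  rw [h3]
  gcongr
  rw [mul_assoc, mul_comm (nakagami m 1 _), ENNReal.inv_mul_le_iff h2pi ENNReal.ofReal_ne_top]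
  exact h2

/-- With at least `2M` cones, each cone is compatible with one symbol only, unless the noise is
comparable to the fading coefficient. -/
lemma exists_symbolErrorProb_le_of_fine (hmodel : IsFadingPSKModel P M m X H W)
    (hM : 2 ≤ M) (hMn : 2 * M ≤ 2 ^ n) (hm : 0 < m)
    (hxhat : ∀ snr, 0 < snr → IsOptimumDetector P M n X H W snr (xhat snr)) :
    ∃ K : ℝ, ∀ snr, 0 < snr →
      symbolErrorProb P n X H W snr (xhat snr) ≤ K * snr ^ (-m) := by
  have hn : 1 ≤ n := by
    by_contra h
    have : n = 0 := by omega
    subst this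
    omega
  have hpi := Real.pi_pos
  have hM0 : (0 : ℝ) < M := by exact_mod_cast (by omega : 0 < M)
  -- each of the two turns costs less than a quarter of the angle between neighbouring symbols
  obtain ⟨c, hc0, hc1, hc⟩ := exists_angle_add_lt (δ := Real.pi / (2 * M)) (by positivity)
  have hwidth : 2 * Real.pi / 2 ^ n ≤ Real.pi / M := by
    have : (2 : ℝ) * M ≤ 2 ^ n := by exact_mod_cast hMn
    rw [div_le_div_iff₀ (by positivity) hM0]
    nlinarith
  obtain ⟨K, hK⟩ := hmodel.exists_measure_le_norm_W_le (f := fun h => c * ‖h‖) (by fun_prop)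
    (a := 2 * m) (by linarith)
    (C := ENNReal.ofReal (2 * m ^ m / Real.Gamma m / (2 * m)) *
      ENNReal.ofReal (c⁻¹ ^ (2 * m))) (by finiteness) (by
      intro ε hε
      have h := nakagami_Iic_le hm (ε := c⁻¹ * ε) (by positivity)
      rw [Real.mul_rpow (by positivity) hε, ENNReal.ofReal_mul (by positivity), ← mul_assoc,
        ← hmodel.map_H_norm_le] at h
      simp_rw [← div_eq_inv_mul, le_div_iff₀' hc0] at h
      exact h)
  refine ⟨K, fun snr h0 => ?_⟩
  have hs : 0 < Real.sqrt snr := Real.sqrt_pos.2 h0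
  have hbound := hK (Real.sqrt snr) hs
  rw [sqrt_rpow_neg h0.le, mul_div_cancel_left₀ _ two_ne_zero] at hbound
  refine le_trans ?_ hbound
  have hnorm : ∀ h : ℂ, ∀ x ∈ constellation M,
      ‖(Real.sqrt snr : ℂ) * h * x‖ = Real.sqrt snr * ‖h‖ := by
    intro h x hx
    rw [norm_mul, norm_mul, norm_of_mem_constellation hx, mul_one, Complex.norm_real,
      Real.norm_of_nonneg hs.le]
  refine (hmodel.symbolErrorProb_le_of_disjoint (hxhat snr h0)
    (A := fun x => {z | ∃ y ∈ region n z.1, ‖y - (Real.sqrt snr : ℂ) * z.2 * x‖ <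
      Real.sqrt snr * (c * ‖z.2‖)}) ?_ ?_).trans (measureReal_mono ?_ (by finiteness))
  · intro x hx
    refine measurableSet_prod_of_slices fun k => IsOpen.measurableSet ?_
    have : {h : ℂ | ∃ y ∈ region n k, ‖y - (Real.sqrt snr : ℂ) * h * x‖ <
        Real.sqrt snr * (c * ‖h‖)} = ⋃ y ∈ region n k, {h : ℂ | ‖y - (Real.sqrt snr : ℂ) * h * x‖ <
        Real.sqrt snr * (c * ‖h‖)} := by
      ext h
      simp
    change IsOpen {h : ℂ | ∃ y ∈ region n k, ‖y - (Real.sqrt snr : ℂ) * h * x‖ <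
        Real.sqrt snr * (c * ‖h‖)}
    rw [this]
    exact isOpen_biUnion fun y _ => isOpen_lt (by fun_prop) (by fun_prop)
  · rintro x hx x' hx' ⟨k, h⟩ ⟨y, hy, hyx⟩ ⟨y', hy', hyx'⟩
    by_contra hne
    dsimp only at hy hyx hy' hyx'
    have hh : 0 < ‖h‖ := by
      have := (norm_nonneg _).trans_lt hyx
      exact pos_of_mul_pos_right (pos_of_mul_pos_right this hs.le) hc0.le
    have hturn : ∀ x ∈ constellation M, ∀ y : ℂ,
        ‖y - (Real.sqrt snr : ℂ) * h * x‖ < Real.sqrt snr * (c * ‖h‖) →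
        y ≠ 0 ∧ InnerProductGeometry.angle ((Real.sqrt snr : ℂ) * h * x) y <
          Real.pi / (2 * M) := by
      intro x hx y hyx
      have hx0 : (Real.sqrt snr : ℂ) * h * x ≠ 0 := by
        rw [← norm_pos_iff, hnorm h x hx]
        positivity
      have hlt : ‖y - (Real.sqrt snr : ℂ) * h * x‖ < c * ‖(Real.sqrt snr : ℂ) * h * x‖ := by
        rw [hnorm h x hx]
        linarith
      refine ⟨?_, ?_⟩
      · rintro rfl
        rw [zero_sub, norm_neg] at hlt
        nlinarith [norm_nonneg ((Real.sqrt snr : ℂ) * h * x)]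
      · have := hc _ (y - (Real.sqrt snr : ℂ) * h * x) hx0 hlt
        rwa [add_sub_cancel] at this
    obtain ⟨hy0, ha⟩ := hturn x hx y hyx
    obtain ⟨hy0', ha'⟩ := hturn x' hx' y' hyx'
    have hsep := le_angle_of_mem_constellation hx hx' hne
    have hsh : (Real.sqrt snr : ℂ) * h ≠ 0 :=
      mul_ne_zero (by exact_mod_cast hs.ne') (norm_pos_iff.1 hh)
    rw [← Complex.angle_mul_left hsh] at hsep
    have ht1 := InnerProductGeometry.angle_le_angle_add_angle ((Real.sqrt snr : ℂ) * h * x) y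
      ((Real.sqrt snr : ℂ) * h * x')
    have ht2 := InnerProductGeometry.angle_le_angle_add_angle y y'
      ((Real.sqrt snr : ℂ) * h * x')
    rw [InnerProductGeometry.angle_comm y'] at ht2
    have hreg := angle_lt_of_mem_region hn hy0 hy0' hy hy'
    have hsum : Real.pi / (2 * M) + (Real.pi / M + Real.pi / (2 * M)) = 2 * Real.pi / M := by
      field_simp
      ring
    linarith
  · intro ω hω
    by_contra hlt
    apply hω
    refine ⟨received X H W snr ω, (quantizer_eq_iff n _ _).1 rfl, ?_⟩
    have : received X H W snr ω - (Real.sqrt snr : ℂ) * H ω * X ω = W ω := by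
      rw [received]; ring
    simp only [observation]
    rw [this]
    exact not_le.1 hlt

/-- With `2ⁿ = M` cones, the noise-free received signal determines the symbol, and noise only
matters when it is larger than the distance to a boundary ray. -/
lemma exists_symbolErrorProb_le_of_coarse (hmodel : IsFadingPSKModel P M m X H W)
    (hn : 1 ≤ n) (hMn : M = 2 ^ n) (hm : 1 / 2 ≤ m)
    (hxhat : ∀ snr, 0 < snr → IsOptimumDetector P M n X H W snr (xhat snr))
    {a : ℝ} (ha : 0 < a) (ha1 : a < 1) :
    ∃ K : ℝ, ∀ snr, 0 < snr →
      symbolErrorProb P n X H W snr (xhat snr) ≤ K * snr ^ (-(a / 2)) := by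
  set C := (finite_constellation M).toFinset with hC
  have hmem : ∀ x, x ∈ C ↔ x ∈ constellation M := fun x => by simp [hC]
  have hIm : ∀ (j : ℕ) (x : ℂ), x ∈ constellation M → ∃ K : ℝ, ∀ t, 0 < t →
      P.real {ω | t * |boundaryCoord n j (H ω * x)| ≤ ‖W ω‖} ≤ K * t ^ (-a) := by
    intro j x hx
    have hmeas : Measurable fun h : ℂ => |boundaryCoord n j (h * x)| := by
      unfold boundaryCoord
      fun_prop
    refine hmodel.exists_measure_le_norm_W_le (f := fun h => |boundaryCoord n j (h * x)|) hmeas ha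
      (lintegral_nakagami_rpow_neg_ne_top (m := m) (a := a) (by linarith) (by linarith)) ?_
    intro ε hε
    have hv : ‖(starRingEnd ℂ) (boundaryRay n j) * x‖ = 1 := by
      rw [norm_mul, RCLike.norm_conj, norm_boundaryRay, norm_of_mem_constellation hx, one_mul]
    refine le_trans (le_of_eq ?_) (hmodel.map_H_abs_im_le ha ha1 hε)
    rw [← hmodel.map_H_mul hv (S := {h : ℂ | |h.im| ≤ ε})
      (measurableSet_le (by fun_prop) measurable_const)]
    congr 1
    ext h
    simp only [boundaryCoord, Set.mem_ofPred_eq]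
    rw [mul_comm h, mul_assoc]
  choose! K hK using hIm
  refine ⟨∑ x ∈ C, ∑ j ∈ Finset.range (2 ^ n + 1), K j x, fun snr h0 => ?_⟩
  have hs : 0 < Real.sqrt snr := Real.sqrt_pos.2 h0
  have hsc : (Real.sqrt snr : ℂ) ≠ 0 := by exact_mod_cast hs.ne'
  have hcalc : P.real (⋃ x ∈ C, ⋃ j ∈ Finset.range (2 ^ n + 1),
      {ω | Real.sqrt snr * |boundaryCoord n j (H ω * x)| ≤ ‖W ω‖}) ≤
      (∑ x ∈ C, ∑ j ∈ Finset.range (2 ^ n + 1), K j x) * snr ^ (-(a / 2)) := by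
    rw [Finset.sum_mul]
    refine (measureReal_biUnion_finset_le _ _).trans (Finset.sum_le_sum fun x hx => ?_)
    rw [Finset.sum_mul]
    refine (measureReal_biUnion_finset_le _ _).trans (Finset.sum_le_sum fun j _ => ?_)
    rw [← sqrt_rpow_neg h0.le]
    exact hK j x ((hmem x).1 hx) _ hs
  refine le_trans ?_ hcalc
  refine (hmodel.symbolErrorProb_le_of_disjoint (hxhat snr h0)
    (A := fun x => {z | (Real.sqrt snr : ℂ) * z.2 * x ∈ region n z.1 ∧ z.2 ≠ 0}) ?_ ?_).trans
    (measureReal_mono ?_ (measure_ne_top _ _))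
  · intro x hx
    refine measurableSet_prod_of_slices fun k => ?_
    exact ((measurableSet_region n k).preimage
      (by fun_prop : Measurable fun h : ℂ => (Real.sqrt snr : ℂ) * h * x)).inter
      (measurableSet_singleton 0).compl
  · rintro x hx x' hx' ⟨k, h⟩ ⟨hxk, hh⟩ ⟨hxk', -⟩
    by_contra hne
    have hsh : (Real.sqrt snr : ℂ) * h ≠ 0 := mul_ne_zero hsc hh
    have hx0 : ∀ x ∈ constellation M, x ≠ 0 := fun x hx => by
      rw [← norm_pos_iff, norm_of_mem_constellation hx]; exact one_pos
    have h1 := angle_lt_of_mem_region hn (mul_ne_zero hsh (hx0 x hx))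
      (mul_ne_zero hsh (hx0 x' hx')) hxk hxk'
    have h2 := le_angle_of_mem_constellation hx hx' hne
    rw [Complex.angle_mul_left hsh] at h1
    rw [hMn] at h2
    push_cast at h2
    linarith
  · intro ω hω
    simp only [Set.mem_iUnion]
    by_contra! hcon
    have hlt : ∀ j ∈ Finset.range (2 ^ n + 1),
        ‖W ω‖ < |boundaryCoord n j ((Real.sqrt snr : ℂ) * H ω * X ω)| := by
      intro j hj
      have := hcon (X ω) ((hmem _).2 (hmodel.X_mem ω)) j hj
      rw [Set.mem_ofPred_eq, not_le] at this
      rwa [mul_assoc, boundaryCoord_ofReal_mul, abs_mul, abs_of_pos hs]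
    apply hω
    have hreg : (Real.sqrt snr : ℂ) * H ω * X ω ∈
        region n (quantizer n ((Real.sqrt snr : ℂ) * H ω * X ω)) := (quantizer_eq_iff n _ _).1 rfl
    have hq : quantizer n (received X H W snr ω) =
        quantizer n ((Real.sqrt snr : ℂ) * H ω * X ω) :=
      (quantizer_eq_iff n _ _).2 (add_mem_region hn hreg hlt)
    refine ⟨?_, ?_⟩
    · simp only [observation]
      rw [hq]
      exact hreg
    · intro hH
      change H ω = 0 at hH
      have := hlt 0 (by simp)
      simp only [hH, boundaryCoord, mul_zero, zero_mul, Complex.zero_im, abs_zero] at this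
      exact absurd this (not_lt.2 (norm_nonneg _))

end IsFadingPSKModel

end PhaseQuant

theorem theorem4 {Ω : Type*} [MeasurableSpace Ω] (P : Measure Ω) [IsProbabilityMeasure P]
    (M n : ℕ) (hM : 2 ≤ M) (hMpow : ∃ b : ℕ, M = 2 ^ b)
    (m : ℝ) (hm : 1 / 2 ≤ m)
    (X H W : Ω → ℂ) (hmodel : PhaseQuant.IsFadingPSKModel P M m X H W)
    (xhat : ℝ → Fin (2 ^ n) × ℂ → ℂ)
    (hxhat : ∀ snr : ℝ, 0 < snr →
      PhaseQuant.IsOptimumDetector P M n X H W snr (xhat snr)) :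
    ((n : ℝ) = Real.logb 2 M →
      PhaseQuant.HasDiversityOrder
        (fun snr => PhaseQuant.symbolErrorProb P n X H W snr (xhat snr)) (1 / 2)) ∧
    (Real.logb 2 M + 1 ≤ (n : ℝ) →
      PhaseQuant.HasDiversityOrder
        (fun snr => PhaseQuant.symbolErrorProb P n X H W snr (xhat snr)) m) := by
  obtain ⟨b, hb⟩ := hMpow
  have hb1 : 1 ≤ b := by
    by_contra h
    have : b = 0 := by omega
    subst this
    omega
  have hlogb : Real.logb 2 M = b := by
    rw [hb, Nat.cast_pow, Nat.cast_ofNat, Real.logb_pow, Real.logb_self_eq_one one_lt_two, mul_one]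
  have hm0 : 0 < m := by linarith
  have hmeas : ∀ snr, 0 < snr → Measurable (xhat snr) := fun snr h => (hxhat snr h).1
  rw [hlogb]
  constructor
  · intro hn
    have hnb : n = b := by exact_mod_cast hn
    have hMn : M = 2 ^ n := by rw [hb, hnb]
    have hn1 : 1 ≤ n := by omega
    obtain ⟨c, hc, hlow⟩ :=
      hmodel.exists_le_symbolErrorProb_of_alignment hM hn1 hMn hm0 hmeas
    refine PhaseQuant.hasDiversityOrder_of_bounds (by norm_num) hc hlow fun a ha ha1 => ?_
    obtain ⟨K, hK⟩ := hmodel.exists_symbolErrorProb_le_of_coarse hn1 hMn hm hxhat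
      (a := 2 * a) (by linarith) (by linarith)
    rw [mul_div_cancel_left₀ _ two_ne_zero] at hK
    exact ⟨K, (eventually_gt_atTop 0).mono hK⟩
  · intro hn
    have hnb : b + 1 ≤ n := by exact_mod_cast hn
    have hMn : 2 * M ≤ 2 ^ n := by
      rw [hb, ← pow_succ']
      exact Nat.pow_le_pow_right two_pos hnb
    have hn1 : 1 ≤ n := by omega
    obtain ⟨c, hc, hlow⟩ := hmodel.exists_le_symbolErrorProb_of_deep_fade hM hn1 hm0 hmeas
    refine PhaseQuant.hasDiversityOrder_of_bounds hm0 hc hlow fun a ha ha1 => ?_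
    obtain ⟨K, hK⟩ := hmodel.exists_symbolErrorProb_le_of_fine hM hMn hm0 hxhat
    refine ⟨|K|, ?_⟩
    filter_upwards [eventually_ge_atTop 1] with snr hsnr
    have h0 : 0 < snr := by linarith
    calc _ ≤ K * snr ^ (-m) := hK snr h0
      _ ≤ |K| * snr ^ (-m) := by gcongr; exact le_abs_self K
      _ ≤ |K| * snr ^ (-a) := by gcongr
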